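/- Let $x(z)=z+1/z$ on the Riemann sphere, and let $\ln$ be the determination of the logarithm with branch cut on $-\mathrm{i}\,\mathbb{R}_{\ge 0}$ and $\ln 1=0$. Let $Z(x)=\tfrac12\big(x+\sqrt{x-2}\,\sqrt{x+2}\big)$ (principal square roots), the holomorphic right inverse of $z\mapsto x(z)$ on $\mathbb{C}\setminus[-2,2]$ with $|Z(x)|>1$. Let $H_n=\sum_{j=1}^n 1/j$. For a meromorphic $1$-form $f$ on the sphere without poles on the closed imaginary axis $\mathrm{i}\mathbb{R}\cup\{\infty\}$, put, for $b\ge 0$, $$\mathcal{I}^1_b[f]=-\mathop{\mathrm{Res}}_{z=\infty}\frac{x(z)^{b+1}}{(b+1)!}f(z),\qquad \mathcal{I}^1_{-1}[f]=0,\qquad \mathcal{R}_b[f]=f-\sum_{a=0}^{b-1}\frac{(a+1)!\,\mathrm{d}x}{x^{a+2}}\,\mathcal{I}^1_a[f],$$ and, writing $\check{\mathcal{R}}_b[f](x)\,\mathrm{d}x=\mathcal{R}_b[f](Z(x))$, $$\mathcal{I}^0_b[f]=\lim_{\epsilon\to0^+}\Big(2\,\mathcal{I}^1_{b-1}[f]\ln\epsilon-\int_0^{\mathrm{i}\infty}\frac{x^b}{b!}\,\check{\mathcal{R}}_b[f](x+\mathrm{i}\epsilon)\,\mathrm{d}x-\int_0^{-\mathrm{i}\infty}\frac{x^b}{b!}\,\check{\mathcal{R}}_b[f](x-\mathrm{i}\epsilon)\,\mathrm{d}x\Big).$$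 **Statement.** Let $f$ be a meromorphic $1$-form on the Riemann sphere without poles on $\mathrm{i}\mathbb{R}\cup\{\infty\}$ (in particular none at $0$ and $\infty$) and such that $f(z)+f(1/z)=0$. Then, for every $b\ge 0$, the integrals defining $\mathcal{I}^0_b[f]$ converge absolutely for all $\epsilon>0$ and the limit exists. Put $$\mathcal{A}[f](x_1)=\sum_{a\ \text{pole of}\ f}\ \mathop{\mathrm{Res}}_{z=a}\frac{f(z)\,\ln z}{x_1-x(z)}.$$ With $z_1=Z(x_1)$, we have, when $x_1\to\infty$ in $\mathbb{C}$, $$\mathcal{A}[f](x_1)\sim-2\,\frac{f(z_1)}{\mathrm{d}x(z_1)}\,\ln\big(x(z_1)/z_1\big)+\sum_{b\ge-1}\frac{(b+1)!}{x_1^{b+2}}\Big(2H_{b+1}\,\mathcal{I}^1_b[f]+\mathcal{I}^0_{b+1}[f]\Big),$$ both as an asymptotic expansion to all orders (the error after the terms $b=-1,\dots,N-2$ is $O(|x_1|^{-(N+1)})$ for every $N\ge0$) and as a Laurent series expansion, that is, the series converges and equality holds for all $x_1$ of large enough modulus. If moreover all poles of $f$ are in $\{1,-1\}$, then, for all $x_1$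 of large enough modulus, $\mathcal{A}[f](x_1)$ is the sum of the residues of $f(z)\ln z/(x_1-x(z))$ at $z=1$ and $z=-1$. -/

import Mathlib

open Filter Topology Set

noncomputable section

namespace P1

/-- A meromorphic `1`-form on the Riemann sphere `ℂ ∪ {∞}`, written `f = coeff z dz` in the chart
`z ∈ ℂ`.  It is meromorphic in this chart and in the chart `w = 1/z` at infinity, where
`dz = -dw / w ^ 2`.  Normal form only fixes the values of `coeff`: the analytic value away from the
poles, and `0` at the poles. -/
structure OneForm where
  coeff : ℂ → ℂ
  meromorphicNFAt : ∀ z, MeromorphicNFAt coeff z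
  meromorphicAt_infty : MeromorphicAt (fun w : ℂ => -coeff w⁻¹ / w ^ 2) 0

namespace OneForm

/-- The coefficient of `dw` in the chart `w = 1/z` at infinity. -/
def coeffInfty (f : OneForm) (w : ℂ) : ℂ := -f.coeff w⁻¹ / w ^ 2

/-- `a ∈ ℂ` is a pole of `f`. -/
def IsPole (f : OneForm) (a : ℂ) : Prop := meromorphicOrderAt f.coeff a < 0

/-- `∞` is a pole of `f`. -/
def HasPoleAtInfty (f : OneForm) : Prop := meromorphicOrderAt f.coeffInfty 0 < 0

/-- `f(z) + f(1/z) = 0`, where `f(1/z)` is the pullback `coeff (1/z) d(1/z)`. -/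
def IsOdd (f : OneForm) : Prop := ∀ z : ℂ, z ≠ 0 → f.coeff z + f.coeff z⁻¹ * (-1 / z ^ 2) = 0

/-- The poles in `ℂ` of a meromorphic `1`-form on the sphere are finite in number. -/
theorem finite_poles (f : OneForm) : {a | f.IsPole a}.Finite := by
  have han : ∀ᶠ w in 𝓝[≠] (0 : ℂ), AnalyticAt ℂ f.coeffInfty w :=
    MeromorphicAt.eventually_analyticAt f.meromorphicAt_infty
  have hb : ∀ᶠ z in Bornology.cobounded ℂ, ¬ f.IsPole z := by
    have h1 : Tendsto (fun z : ℂ => z⁻¹) (Bornology.cobounded ℂ) (𝓝[≠] 0) := by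
      rw [← Filter.inv_cobounded₀]
      exact fun s hs => by simpa using hs
    filter_upwards [h1.eventually han, Bornology.eventually_ne_cobounded (0 : ℂ)] with z hz hz0
    have h2 : AnalyticAt ℂ (fun y : ℂ => -(f.coeffInfty y⁻¹ * (y⁻¹) ^ 2)) z := by
      have h3 : AnalyticAt ℂ (fun y : ℂ => y⁻¹) z := analyticAt_inv hz0
      exact ((hz.comp_of_eq h3 rfl).mul (h3.pow 2)).neg
    have h4 : (fun y : ℂ => -(f.coeffInfty y⁻¹ * (y⁻¹) ^ 2)) =ᶠ[𝓝 z] f.coeff := by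
      filter_upwards [isOpen_ne.mem_nhds hz0] with y hy
      have hy' : y ≠ 0 := hy
      simp only [coeffInfty, inv_inv]
      field_simp
    exact not_lt.mpr (h2.congr h4).meromorphicOrderAt_nonneg
  obtain ⟨r, hr⟩ := (Metric.hasBasis_cobounded_compl_closedBall (0 : ℂ)).eventually_iff.mp hb
  have hM : MeromorphicOn f.coeff (Metric.closedBall 0 r) :=
    fun z _ => (f.meromorphicNFAt z).meromorphicAt
  refine ((MeromorphicOn.divisor f.coeff (Metric.closedBall 0 r)).finiteSupport
    (isCompact_closedBall 0 r)).subset fun a ha => ?_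
  have ha' : a ∈ Metric.closedBall (0 : ℂ) r := by
    by_contra h
    exact hr.2 h ha
  have hneg : meromorphicOrderAt f.coeff a < 0 := ha
  rw [Function.mem_support, MeromorphicOn.divisor_apply hM ha']
  intro h0
  rcases WithTop.untop₀_eq_zero.mp h0 with h | h
  · rw [h] at hneg; exact lt_irrefl _ hneg
  · rw [h] at hneg; exact not_top_lt hneg

end OneForm

/-- The residue at `a` of `g z dz`, for an isolated singularity `a` of `g`
(the integral over small circles is then independent of the radius). -/
def residue (g : ℂ → ℂ) (a : ℂ) : ℂ :=
  limUnder (𝓝[>] (0 : ℝ)) fun r => (2 * Real.pi * Complex.I)⁻¹ * ∮ z in C(a, r), g z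

/-- The residue at `∞` of `g z dz`, computed in the chart `w = 1/z`. -/
def residueInfty (g : ℂ → ℂ) : ℂ := residue (fun w => -g w⁻¹ / w ^ 2) 0

/-- The function `x(z) = z + 1/z`. -/
def x (z : ℂ) : ℂ := z + z⁻¹

/-- The derivative of `x`, so that `dx = dx z dz`. -/
def dx (z : ℂ) : ℂ := 1 - (z ^ 2)⁻¹

/-- The determination of the logarithm with branch cut on `-i ℝ_{≥ 0}` and value `0` at `1`. -/
def ln (z : ℂ) : ℂ := Complex.log (-Complex.I * z) + Complex.I * (Real.pi / 2)

/-- The inverse `(x + √(x² - 4)) / 2` of `x` on `ℂ \ [-2, 2]`, with values in `|z| > 1`.  The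
square root `√(x² - 4) = √(x - 2) √(x + 2)` is the one that is holomorphic on `ℂ \ [-2, 2]` and
equivalent to `x` at infinity. -/
def Z (y : ℂ) : ℂ := (y + (y - 2) ^ (1 / 2 : ℂ) * (y + 2) ^ (1 / 2 : ℂ)) / 2

/-- `Z` is a right inverse of `x`. -/
theorem x_Z (y : ℂ) : x (Z y) = y := by
  have hs : ∀ c : ℂ, (c ^ (1 / 2 : ℂ)) ^ 2 = c := fun c => by
    simp
  have h : (2 * Z y - y) ^ 2 = y ^ 2 - 4 := by
    have h1 := hs (y - 2)
    have h2 := hs (y + 2)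
    have h3 : 2 * Z y - y = (y - 2) ^ (1 / 2 : ℂ) * (y + 2) ^ (1 / 2 : ℂ) := by
      unfold Z; ring
    rw [h3, mul_pow, h1, h2]; ring
  have h0 : Z y ≠ 0 := fun h0 => by
    rw [h0] at h
    have : (4 : ℂ) = 0 := by linear_combination h
    norm_num at this
  unfold x
  field_simp
  linear_combination h / 4

/-- `𝓘¹_b[f] = - Res_∞ x^(b+1) / (b+1)! f`. -/
def I1 (f : OneForm) (b : ℕ) : ℂ :=
  -residueInfty fun z => x z ^ (b + 1) / (b + 1).factorial * f.coeff z

/-- `𝓘¹_{b-1}[f]`, with the convention `𝓘¹_{-1} = 0`. -/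
def I1Pred (f : OneForm) : ℕ → ℂ
  | 0 => 0
  | b + 1 => I1 f b

/-- The coefficient of `dx` in `𝓡_b[f](Z(x))`, where
`𝓡_b[f] = f - ∑_{a < b} (a+1)! dx / x^(a+2) 𝓘¹_a[f]`. -/
def R (f : OneForm) (b : ℕ) (y : ℂ) : ℂ :=
  f.coeff (Z y) / dx (Z y) - ∑ a ∈ Finset.range b, (a + 1).factorial / y ^ (a + 2) * I1 f a

/-- For a direction `s`, the integrand in `u > 0` of the integral along the ray `x = s u` of
`x ^ b / b! 𝓡_b[f](Z(x + s ε))`. -/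
def rayIntegrand (f : OneForm) (b : ℕ) (ε : ℝ) (s : ℂ) (u : ℝ) : ℂ :=
  (s * u) ^ b / b.factorial * R f b (s * u + s * ε) * s

/-- The quantity whose limit for `ε → 0⁺` is `𝓘⁰_b[f]`; the two integrals are those from `0` to
`i∞` and from `0` to `-i∞`. -/
def I0Reg (f : OneForm) (b : ℕ) (ε : ℝ) : ℂ :=
  2 * I1Pred f b * Real.log ε
    - (∫ u in Ioi (0 : ℝ), rayIntegrand f b ε Complex.I u)
    - ∫ u in Ioi (0 : ℝ), rayIntegrand f b ε (-Complex.I) u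

/-- The regularised contour integral `𝓘⁰_b[f]`. -/
def I0 (f : OneForm) (b : ℕ) : ℂ := limUnder (𝓝[>] (0 : ℝ)) (I0Reg f b)

/-- The residue at `z = a` of `f(z) ln z / (x₁ - x(z))`. -/
def resLog (f : OneForm) (x₁ a : ℂ) : ℂ := residue (fun z => f.coeff z * ln z / (x₁ - x z)) a

/-- `𝓐[f](x₁)`, the sum over the poles `a` of `f` of the residues of `f(z) ln z / (x₁ - x(z))`. -/
def A (f : OneForm) (x₁ : ℂ) : ℂ := ∑ᶠ a ∈ {a | f.IsPole a}, resLog f x₁ a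

/-- The term `-2 f(z₁)/dx(z₁) ln(x(z₁)/z₁)`, where `z₁ = Z(x₁)` is the point near `∞` above `x₁`. -/
def logTerm (f : OneForm) (x₁ : ℂ) : ℂ :=
  -2 * (f.coeff (Z x₁) / dx (Z x₁)) * ln (x (Z x₁) / Z x₁)

/-- The term of index `n = b + 1` of the expansion,
`(b+1)! / x₁^(b+2) (2 H_{b+1} 𝓘¹_b[f] + 𝓘⁰_{b+1}[f])`. -/
def expansionTerm (f : OneForm) (x₁ : ℂ) (n : ℕ) : ℂ :=
  n.factorial / x₁ ^ (n + 1) * (2 * (harmonic n : ℂ) * I1Pred f n + I0 f n)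

end P1

end

/-!
Write `z = e^w`, so that `x(z) = 2 cosh w`, `ln z = w`, the cut along `-i ℝ_{≥ 0}` becomes the
pair of lines `Im w = -π/2` and `Im w = 3π/2`, and the symmetry `f(z) + f(1/z) = 0` says that the
coefficient of `dw` is even in `w`.

By the residue theorem (`rectInt_eq_sum_residue`) `2πi 𝓐[f](x₁)` is the integral of
`f(z) ln z / (x₁ - x(z))` over the boundary of the rectangle `[-T, T] × [-π/2, 3π/2]`. The geometric series of
`1 / (x₁ - x(z))` turns this into a Laurent series in `x₁` whose `n`-th coefficient is the same
contour integral with `x(z)^n` instead (`hasExpansion_A`), and these do not depend on `T`. It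
remains to evaluate them as `T → ∞` (`coeff_A_sub_coeff_logTerm`).

The logarithm jumps by `2πi` across the cut, so the two horizontal sides leave an integral of
`x^n f` along the negative imaginary axis, without logarithm; the symmetry folds its inner half onto
the positive imaginary ray in the variable `x`. The symmetry also turns the left vertical side
into a second copy of the right one, cut at the other end of the imaginary axis
(`rectInt_mul_self`). On these two circles `ln z = ln x - ln (x/z)`. The part with `ln (x/z)`
extracts the coefficients of the expansion of `-2 f/dx ln (x/z)`. In the part with `ln x` only the
terms of `f/dx` of order at least `x^(-n-1)` survive, and they are integrated by primitives
(`HasExpansion.tendsto_arc_log`): this produces exactly the counterterms that make the integrals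
along the rays converge.

On the other side, the regularisation `x ↦ x + iε` in `𝓘⁰` differs from cutting the rays at a
small distance only through `∫ u^n / (u + ε)^(n+1) du = -log ε - H_n + ⋯`
(`integral_pow_div_pow_succ`). This is the origin of the harmonic numbers, and gives the same
finite parts (`tendsto_I0Reg`).
-/

namespace P1
open Complex (I exp)

/-! ### The inverse branch at infinity and the logarithm -/

theorem norm_sub_le_norm_add_of_inner_nonneg {a b : ℂ} (h : 0 ≤ a.re * b.re + a.im * b.im) :
    ‖b - a‖ ≤ ‖a + b‖ := by
  rw [← sq_le_sq₀ (norm_nonneg _) (norm_nonneg _), Complex.sq_norm, Complex.sq_norm,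
    Complex.normSq_apply, Complex.normSq_apply]
  simp only [Complex.sub_re, Complex.sub_im, Complex.add_re, Complex.add_im]
  nlinarith

theorem sqrt_re_nonneg (c : ℂ) : 0 ≤ (c ^ (1 / 2 : ℂ)).re := by
  rcases eq_or_ne c 0 with rfl | hc
  · simp
  rw [Complex.cpow_def_of_ne_zero hc, Complex.exp_re]
  refine mul_nonneg (Real.exp_pos _).le (Real.cos_nonneg_of_mem_Icc ?_)
  have h1 := Complex.neg_pi_lt_log_im c
  have h2 := Complex.log_im_le_pi c
  have h3 : (Complex.log c * (1 / 2)).im = (Complex.log c).im / 2 := by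
    simp [Complex.mul_im]; ring
  rw [h3]
  constructor <;> linarith

theorem sqrt_im_nonneg {c : ℂ} (h : 0 ≤ c.im) : 0 ≤ (c ^ (1 / 2 : ℂ)).im := by
  rcases eq_or_ne c 0 with rfl | hc
  · simp
  rw [Complex.cpow_def_of_ne_zero hc, Complex.exp_im]
  have h3 : (Complex.log c * (1 / 2)).im = Complex.arg c / 2 := by
    simp [Complex.mul_im, Complex.log_im]; ring
  have h1 := Complex.arg_nonneg_iff.mpr h
  have h2 := Complex.arg_le_pi c
  refine mul_nonneg (Real.exp_pos _).le (Real.sin_nonneg_of_nonneg_of_le_pi ?_ ?_) <;>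
    rw [h3] <;> linarith

theorem sqrt_im_nonpos {c : ℂ} (h : c.im < 0) : (c ^ (1 / 2 : ℂ)).im ≤ 0 := by
  have hc : c ≠ 0 := by rintro rfl; simp at h
  rw [Complex.cpow_def_of_ne_zero hc, Complex.exp_im]
  have h3 : (Complex.log c * (1 / 2)).im = Complex.arg c / 2 := by
    simp [Complex.mul_im, Complex.log_im]; ring
  have h1 := Complex.arg_neg_iff.mpr h
  have h2 := Complex.neg_pi_lt_arg c
  refine mul_nonpos_of_nonneg_of_nonpos (Real.exp_pos _).le
    (Real.sin_nonpos_of_nonpos_of_neg_pi_le ?_ ?_) <;> rw [h3] <;> linarith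

/-- Since `4 Z = (√(y-2) + √(y+2))²` and `4 / Z = (√(y+2) - √(y-2))²`, this is the fact that
the two principal square roots make an acute angle. -/
theorem one_le_norm_Z (y : ℂ) : 1 ≤ ‖Z y‖ := by
  set a := (y - 2) ^ (1 / 2 : ℂ) with ha
  set b := (y + 2) ^ (1 / 2 : ℂ) with hb
  have hs : ∀ c : ℂ, (c ^ (1 / 2 : ℂ)) ^ 2 = c := fun c => by simp
  have ha2 : a ^ 2 = y - 2 := hs _
  have hb2 : b ^ 2 = y + 2 := hs _
  have hZ : 4 * Z y = (a + b) ^ 2 := by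
    have : Z y = (y + a * b) / 2 := rfl
    rw [this]; linear_combination -ha2 - hb2
  have hprod : (a + b) * (b - a) = 4 := by linear_combination hb2 - ha2
  have him : 0 ≤ a.im * b.im := by
    rcases le_or_gt 0 y.im with h | h
    · exact mul_nonneg (sqrt_im_nonneg (by simpa using h)) (sqrt_im_nonneg (by simpa using h))
    · exact mul_nonneg_of_nonpos_of_nonpos (sqrt_im_nonpos (by simpa using h))
        (sqrt_im_nonpos (by simpa using h))
  have hre : 0 ≤ a.re * b.re := mul_nonneg (sqrt_re_nonneg _) (sqrt_re_nonneg _)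
  have hle := norm_sub_le_norm_add_of_inner_nonneg (add_nonneg hre him)
  have h4 : ‖a + b‖ * ‖b - a‖ = 4 := by rw [← norm_mul, hprod]; simp
  have h5 : 4 * ‖Z y‖ = ‖a + b‖ ^ 2 := by rw [← norm_pow, ← hZ, norm_mul]; simp
  nlinarith [norm_nonneg (a + b)]

/-- `Z (x z)` is `z` or `1/z`, and `|Z| ≥ 1` everywhere excludes the latter. -/
theorem Z_x {z : ℂ} (hz : 1 < ‖z‖) : Z (x z) = z := by
  have hz0 : z ≠ 0 := by rintro rfl; simp at hz; linarith
  have h1 := one_le_norm_Z (x z)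
  have hZ0 : Z (x z) ≠ 0 := by intro h; rw [h] at h1; simp at h1; linarith
  have h2 := x_Z (x z)
  set ζ := Z (x z)
  have h3 : (ζ - z) * (ζ * z - 1) = 0 := by
    unfold x at h2; field_simp at h2; linear_combination h2
  rcases mul_eq_zero.mp h3 with h | h
  · exact sub_eq_zero.mp h
  · exfalso
    have h4 : ‖ζ‖ * ‖z‖ = 1 := by rw [← norm_mul, sub_eq_zero.mp h]; simp
    nlinarith

/-- On the strip that `exp` maps to the slit plane, `ln` inverts `exp`; the closed upper edge is the
side of the cut on which `ln` takes its values. -/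
theorem ln_exp {w : ℂ} (h1 : -(Real.pi / 2) < w.im) (h2 : w.im ≤ 3 * Real.pi / 2) :
    ln (exp w) = w := by
  have h : -I * exp w = exp (w - Real.pi / 2 * I) := by
    rw [Complex.exp_sub, Complex.exp_pi_div_two_mul_I, div_eq_mul_inv, Complex.inv_I]; ring
  have him : (w - Real.pi / 2 * I).im = w.im - Real.pi / 2 := by simp
  unfold ln
  rw [h, Complex.log_exp (by rw [him]; linarith) (by rw [him]; linarith)]
  ring

theorem ln_eq_log {z : ℂ} (hz : 0 < z.re) : ln z = Complex.log z := by
  have hz0 : z ≠ 0 := by rintro rfl; simp at hz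
  have h := abs_lt.mp (Complex.abs_arg_lt_pi_div_two_iff.mpr (Or.inl hz))
  have hp := Real.pi_pos
  conv_lhs => rw [← Complex.exp_log hz0]
  exact ln_exp (by rw [Complex.log_im]; exact h.1) (by rw [Complex.log_im]; linarith [h.2])

theorem analyticAt_ln {z : ℂ} (hz : z.re ≠ 0) : AnalyticAt ℂ ln z := by
  have : -I * z ∈ Complex.slitPlane := Or.inr (by simpa using hz)
  unfold ln
  fun_prop (disch := assumption)

theorem analyticAt_coeff {f : OneForm} {a : ℂ} (h : ¬ f.IsPole a) : AnalyticAt ℂ f.coeff a :=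
  (f.meromorphicNFAt a).meromorphicOrderAt_nonneg_iff_analyticAt.mp (not_lt.mp h)

/-- `invZRatio w = 1 / (w Z(1/w))`, made analytic at `w = 0`. -/
noncomputable def invZRatio (w : ℂ) : ℂ := 2 / (1 + (1 - 4 * w ^ 2) ^ (1 / 2 : ℂ))

theorem invZRatio_zero : invZRatio 0 = 1 := by
  norm_num [invZRatio]

theorem analyticAt_invZRatio : AnalyticAt ℂ invZRatio 0 := by
  unfold invZRatio
  have h1 : (1 - 4 * (0 : ℂ) ^ 2) ∈ Complex.slitPlane := by simp
  have h2 : AnalyticAt ℂ (fun w : ℂ => (1 - 4 * w ^ 2) ^ (1 / 2 : ℂ)) 0 := by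
    fun_prop (disch := assumption)
  refine analyticAt_const.div (analyticAt_const.add h2) ?_
  norm_num

theorem eventually_Z_inv : ∀ᶠ w in 𝓝[≠] (0 : ℂ), Z w⁻¹ = (w * invZRatio w)⁻¹ := by
  have h1 : Tendsto (fun w => w * invZRatio w) (𝓝 0) (𝓝 0) := by
    have := (continuousAt_id (x := (0:ℂ))).mul analyticAt_invZRatio.continuousAt
    simpa [ContinuousAt, Pi.mul_def] using this
  have h2 : ∀ᶠ w in 𝓝 (0 : ℂ), 1 + (1 - 4 * w ^ 2) ^ (1 / 2 : ℂ) ≠ 0 := by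
    have := analyticAt_invZRatio.continuousAt.eventually_ne (y := 0) (by simp [invZRatio_zero])
    filter_upwards [this] with w hw h
    exact hw (by simp only [invZRatio, h, div_zero])
  filter_upwards [nhdsWithin_le_nhds h2, self_mem_nhdsWithin,
    nhdsWithin_le_nhds (h1.eventually (Metric.ball_mem_nhds 0 one_pos))] with w hw hw0 hb
  have hw0 : w ≠ 0 := hw0
  have hr : invZRatio w ≠ 0 := by
    simp only [invZRatio]; exact div_ne_zero two_ne_zero hw
  have hn : 1 < ‖(w * invZRatio w)⁻¹‖ := by
    rw [norm_inv]
    refine one_lt_inv_iff₀.mpr ⟨norm_pos_iff.mpr (mul_ne_zero hw0 hr), by simpa using hb⟩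
  rw [← Z_x hn]
  congr 1
  have hs : ((1 - 4 * w ^ 2) ^ (1 / 2 : ℂ)) ^ 2 = 1 - 4 * w ^ 2 := by simp
  simp only [x, invZRatio, inv_inv]
  set s := (1 - 4 * w ^ 2) ^ (1 / 2 : ℂ)
  field_simp
  linear_combination -hs

/-! ### Convergent Laurent expansions at infinity -/

/-- `Q` has the convergent Laurent expansion `∑ p k / y ^ (k + 1)` near `y = ∞`. -/
def HasExpansion (Q : ℂ → ℂ) (p : ℕ → ℂ) : Prop :=
  ∀ᶠ y in Bornology.cobounded ℂ, HasSum (fun k => p k / y ^ (k + 1)) (Q y)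

theorem tendsto_inv_cobounded_punctured :
    Tendsto (fun z : ℂ => z⁻¹) (Bornology.cobounded ℂ) (𝓝[≠] 0) := by
  rw [← Filter.inv_cobounded₀]
  exact fun s hs => by simpa using hs

theorem tendsto_inv_punctured_cobounded :
    Tendsto (fun z : ℂ => z⁻¹) (𝓝[≠] 0) (Bornology.cobounded ℂ) :=
  Filter.tendsto_inv₀_nhdsNE_zero

namespace HasExpansion

theorem of_analyticAt {Q P : ℂ → ℂ} (hP : AnalyticAt ℂ P 0)
    (h : ∀ᶠ w in 𝓝[≠] (0 : ℂ), Q w⁻¹ = w * P w) :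
    ∃ p, HasExpansion Q p ∧ p 0 = P 0 := by
  obtain ⟨p, hp⟩ := hP
  refine ⟨p.coeff, ?_, hp.coeff_zero _⟩
  rw [hasFPowerSeriesAt_iff] at hp
  filter_upwards [tendsto_inv_cobounded_punctured.eventually h,
    tendsto_inv_cobounded_punctured.eventually (nhdsWithin_le_nhds hp)] with y h1 h2
  rw [inv_inv] at h1
  rw [h1]
  rw [zero_add] at h2
  refine (h2.mul_left y⁻¹).congr_fun fun k => ?_
  rw [smul_eq_mul, pow_succ, div_eq_mul_inv, mul_inv, inv_pow]
  ring

theorem sub {Q Q' : ℂ → ℂ} {p p' : ℕ → ℂ} (h : HasExpansion Q p) (h' : HasExpansion Q' p') :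
    HasExpansion (fun y => Q y - Q' y) (fun k => p k - p' k) := by
  filter_upwards [h, h'] with y h1 h2
  simpa only [sub_div] using h1.sub h2

/-- In the chart `1/y`, the expansion is a power series at `0`. -/
theorem exists_hasFPowerSeriesAt {Q : ℂ → ℂ} {p : ℕ → ℂ} (h : HasExpansion Q p) :
    ∃ P : ℂ → ℂ, HasFPowerSeriesAt P (FormalMultilinearSeries.ofScalars ℂ p) 0 ∧
      ∀ᶠ y in Bornology.cobounded ℂ, Q y = y⁻¹ * P y⁻¹ := by
  let P : ℂ → ℂ := fun w => ∑' k, p k * w ^ k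
  refine ⟨P, ?_, ?_⟩
  · rw [hasFPowerSeriesAt_iff]
    have h1 : ∀ᶠ w in 𝓝[≠] (0 : ℂ), HasSum (fun k => p k * w ^ k) (P w) := by
      filter_upwards [tendsto_inv_punctured_cobounded.eventually h, self_mem_nhdsWithin]
        with w hw hw0
      have hw0 : w ≠ 0 := hw0
      have h2 := hw.mul_left w⁻¹
      refine (h2.summable.congr fun k => ?_).hasSum
      rw [inv_pow, div_inv_eq_mul, pow_succ]
      field_simp
    have h0 : HasSum (fun k => p k * (0 : ℂ) ^ k) (P 0) := by
      refine Summable.hasSum (summable_of_ne_finset_zero (s := {0}) fun k hk => ?_)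
      rw [zero_pow (by simpa using hk), mul_zero]
    have h2 : ∀ᶠ w in 𝓝 (0 : ℂ), HasSum (fun k => p k * w ^ k) (P w) := by
      rw [← nhdsNE_sup_pure]
      exact ⟨h1, h0⟩
    filter_upwards [h2] with w hw
    simpa [FormalMultilinearSeries.coeff_ofScalars, mul_comm] using hw
  · filter_upwards [h, Bornology.eventually_ne_cobounded (0 : ℂ)] with y hy hy0
    rw [← tsum_mul_left, ← hy.tsum_eq]
    refine tsum_congr fun k => ?_
    rw [pow_succ, div_eq_mul_inv, mul_inv, inv_pow]; ring

theorem eventually_continuousAt {Q : ℂ → ℂ} {p : ℕ → ℂ} (h : HasExpansion Q p) :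
    ∀ᶠ y in Bornology.cobounded ℂ, ContinuousAt Q y := by
  obtain ⟨P, hP, hQ⟩ := h.exists_hasFPowerSeriesAt
  obtain ⟨r, -, hr⟩ := (Metric.hasBasis_cobounded_compl_closedBall (0 : ℂ)).eventually_iff.mp hQ
  have hb : ∀ᶠ y in Bornology.cobounded ℂ, y ∈ (Metric.closedBall (0 : ℂ) r)ᶜ :=
    (Metric.hasBasis_cobounded_compl_closedBall (0 : ℂ)).mem_of_mem trivial
  filter_upwards [tendsto_inv_cobounded_punctured.eventually
    (nhdsWithin_le_nhds hP.analyticAt.eventually_analyticAt),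
    Bornology.eventually_ne_cobounded (0 : ℂ), hb] with y h1 h2 h3
  have h4 : ContinuousAt (fun y : ℂ => y⁻¹ * P y⁻¹) y :=
    (continuousAt_inv₀ h2).mul
      (ContinuousAt.comp (f := fun y : ℂ => y⁻¹) h1.continuousAt (continuousAt_inv₀ h2))
  refine h4.congr ?_
  filter_upwards [Metric.isClosed_closedBall.isOpen_compl.mem_nhds h3] with y' hy'
  exact (hr hy').symm

theorem isBigO {Q : ℂ → ℂ} {p : ℕ → ℂ} (h : HasExpansion Q p) (N : ℕ) :
    (fun y => Q y - ∑ k ∈ Finset.range N, p k / y ^ (k + 1))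
      =O[Bornology.cobounded ℂ] fun y => (y ^ (N + 1))⁻¹ := by
  obtain ⟨P, hP, hQ⟩ := h.exists_hasFPowerSeriesAt
  have h3 := hP.isBigO_sub_partialSum_pow N
  have h4 := (h3.comp_tendsto (tendsto_inv_cobounded_punctured.mono_right nhdsWithin_le_nhds))
  have h5 : (fun y : ℂ => P y⁻¹ - ∑ k ∈ Finset.range N, p k * (y⁻¹) ^ k)
      =O[Bornology.cobounded ℂ] fun y => (y⁻¹) ^ N := by
    refine (h4.congr_left fun y => ?_).trans (Asymptotics.isBigO_of_le _ fun y => ?_)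
    · simp [FormalMultilinearSeries.partialSum, mul_comm]
    · simp
  refine (((Asymptotics.isBigO_refl (fun y : ℂ => y⁻¹) _).mul h5).congr' ?_
    (EventuallyEq.refl _ _)).trans ?_
  · filter_upwards [hQ] with y hy
    rw [mul_sub, Finset.mul_sum, ← hy]
    congr 1
    refine Finset.sum_congr rfl fun k _ => ?_
    rw [pow_succ, div_eq_mul_inv, mul_inv, inv_pow]; ring
  · refine Asymptotics.isBigO_of_le _ fun y => ?_
    simp [pow_succ, mul_comm]

end HasExpansion

/-- The coefficient of `dy` in `f(Z(y))`. -/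
noncomputable def OneForm.pullback (f : OneForm) (y : ℂ) : ℂ := f.coeff (Z y) / dx (Z y)

/-- A form regular at infinity has a pullback that is analytic at `y = ∞` and of order `y⁻²` there.
-/
theorem exists_pullback_inv (f : OneForm) (hinfty : ¬ f.HasPoleAtInfty) :
    ∃ P : ℂ → ℂ, AnalyticAt ℂ P 0 ∧ P 0 = 0 ∧
      ∀ᶠ w in 𝓝[≠] (0 : ℂ), f.pullback w⁻¹ = w * P w := by
  have hm : MeromorphicAt f.coeffInfty 0 := f.meromorphicAt_infty
  obtain ⟨g, hg, hfg⟩ := hm.meromorphicOrderAt_nonneg_iff.mp (not_lt.mp hinfty)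
  have hr := analyticAt_invZRatio
  have hτ : AnalyticAt ℂ (fun w => w * invZRatio w) 0 := analyticAt_id.mul hr
  have hτ0 : (0 : ℂ) * invZRatio 0 = 0 := zero_mul _
  have hne : ∀ᶠ w in 𝓝[≠] (0 : ℂ), w * invZRatio w ≠ 0 := by
    filter_upwards [self_mem_nhdsWithin, nhdsWithin_le_nhds
      (hr.continuousAt.eventually_ne (y := 0) (by simp [invZRatio_zero]))] with w h1 h2
    exact mul_ne_zero h1 h2
  have ht : Tendsto (fun w => w * invZRatio w) (𝓝[≠] 0) (𝓝[≠] 0) :=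
    tendsto_nhdsWithin_iff.mpr ⟨by
      have := hτ.continuousAt.tendsto
      simp only [hτ0] at this
      exact this.mono_left nhdsWithin_le_nhds, hne⟩
  refine ⟨fun w => -g (w * invZRatio w) * (w * invZRatio w) * invZRatio w /
    (1 - (w * invZRatio w) ^ 2), ?_, by simp, ?_⟩
  · have hg' : AnalyticAt ℂ (fun w => g (w * invZRatio w)) 0 := hg.comp_of_eq hτ hτ0
    exact ((hg'.neg.mul hτ).mul hr).div (analyticAt_const.sub (hτ.pow 2)) (by simp)
  · filter_upwards [eventually_Z_inv, ht.eventually hfg, hne] with w h1 h2 h3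
    rw [OneForm.pullback, h1, dx, inv_pow, inv_inv, ← h2, OneForm.coeffInfty]
    field_simp
    rw [mul_div_mul_left _ _ h3]

theorem exists_hasExpansion_pullback (f : OneForm) (hinfty : ¬ f.HasPoleAtInfty) :
    ∃ p, HasExpansion f.pullback p ∧ p 0 = 0 := by
  obtain ⟨P, hP, hP0, h⟩ := exists_pullback_inv f hinfty
  obtain ⟨p, hp, hp0⟩ := HasExpansion.of_analyticAt hP h
  exact ⟨p, hp, hp0.trans hP0⟩

theorem exists_hasExpansion_logTerm (f : OneForm) (hinfty : ¬ f.HasPoleAtInfty) :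
    ∃ q, HasExpansion (logTerm f) q := by
  obtain ⟨P, hP, hP0, h⟩ := exists_pullback_inv f hinfty
  have hr := analyticAt_invZRatio
  have hl : AnalyticAt ℂ (fun w => ln (invZRatio w)) 0 :=
    (analyticAt_ln (by simp [invZRatio_zero])).comp hr
  obtain ⟨q, hq, -⟩ := HasExpansion.of_analyticAt (Q := logTerm f)
    (P := fun w => -2 * P w * ln (invZRatio w)) ((analyticAt_const.mul hP).mul hl) (by
      filter_upwards [h, eventually_Z_inv, self_mem_nhdsWithin] with w h1 h2 h3
      have h3 : w ≠ 0 := h3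
      have h4 : x (Z w⁻¹) / Z w⁻¹ = invZRatio w := by
        rw [x_Z, h2]; field_simp
      have h5 : logTerm f w⁻¹ = -2 * f.pullback w⁻¹ * ln (x (Z w⁻¹) / Z w⁻¹) := rfl
      rw [h5, h1, h4]; ring)
  exact ⟨q, hq⟩

/-! ### The coordinate `w = log z` -/

theorem x_exp (w : ℂ) : x (exp w) = 2 * Complex.cosh w := by
  rw [x, ← Complex.exp_neg, Complex.cosh]; ring

theorem dx_exp_mul_exp (w : ℂ) : dx (exp w) * exp w = 2 * Complex.sinh w := by
  have h := Complex.exp_ne_zero w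
  rw [dx, Complex.sinh, Complex.exp_neg]; field_simp

theorem Z_two_cosh {w : ℂ} (hw : 0 < w.re) : Z (2 * Complex.cosh w) = exp w := by
  rw [← x_exp, Z_x]
  rw [Complex.norm_exp]; exact Real.one_lt_exp_iff.mpr hw

theorem two_sinh_ne_zero {w : ℂ} (hw : 0 < w.re) : 2 * Complex.sinh w ≠ 0 := by
  intro h
  have h1 : exp w = exp (-w) := by
    have : exp w - exp (-w) = 2 * Complex.sinh w := by rw [Complex.sinh]; ring
    rw [h] at this; exact sub_eq_zero.mp this
  have h2 := congrArg norm h1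
  rw [Complex.norm_exp, Complex.norm_exp, Real.exp_eq_exp, Complex.neg_re] at h2
  linarith

theorem two_cosh_ne_zero {w : ℂ} (hw : 0 < w.re) : 2 * Complex.cosh w ≠ 0 := by
  intro h
  have h1 : exp w = -exp (-w) := by
    have : exp w + exp (-w) = 2 * Complex.cosh w := by rw [Complex.cosh]; ring
    rw [h] at this; exact eq_neg_of_add_eq_zero_left this
  have h2 := congrArg norm h1
  rw [norm_neg, Complex.norm_exp, Complex.norm_exp, Real.exp_eq_exp, Complex.neg_re] at h2
  linarith

theorem pullback_two_cosh (f : OneForm) {w : ℂ} (hw : 0 < w.re) :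
    f.pullback (2 * Complex.cosh w) * (2 * Complex.sinh w) = f.coeff (exp w) * exp w := by
  have h := two_sinh_ne_zero hw
  rw [← dx_exp_mul_exp] at h ⊢
  rw [OneForm.pullback, Z_two_cosh hw]
  field_simp [left_ne_zero_of_mul h]

/-- The branch `w + log (1 + e^(-2w))` of `log (2 cosh w)` on the right half-plane. -/
noncomputable def logCosh (w : ℂ) : ℂ := w + Complex.log (1 + exp (-2 * w))

theorem norm_exp_neg_two_mul_lt_one {w : ℂ} (hw : 0 < w.re) : ‖exp (-2 * w)‖ < 1 := by
  rw [Complex.norm_exp, Real.exp_lt_one_iff]; simp; exact hw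

theorem one_add_re_pos {v : ℂ} (hv : ‖v‖ < 1) : 0 < (1 + v).re := by
  have := abs_lt.mp ((Complex.abs_re_le_norm v).trans_lt hv)
  simp; linarith [this.1]

theorem hasDerivAt_logCosh {w : ℂ} (hw : 0 < w.re) :
    HasDerivAt logCosh (2 * Complex.sinh w / (2 * Complex.cosh w)) w := by
  have h1 : (1 + exp (-2 * w)) ∈ Complex.slitPlane :=
    Or.inl (one_add_re_pos (norm_exp_neg_two_mul_lt_one hw))
  have h2 : HasDerivAt (fun w => 1 + exp (-2 * w)) (exp (-2 * w) * -2) w := by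
    have := ((hasDerivAt_id w).const_mul (-2 : ℂ)).cexp.const_add 1
    simpa using this
  refine ((hasDerivAt_id w).add (h2.clog h1)).congr_deriv ?_
  have h3 := Complex.slitPlane_ne_zero h1
  have h4 := two_cosh_ne_zero hw
  rw [Complex.cosh] at h4
  have h5 : exp (-2 * w) = exp (-w) ^ 2 := by rw [sq, ← Complex.exp_add]; ring_nf
  have h6 : exp w * exp (-w) = 1 := by rw [← Complex.exp_add]; simp
  rw [Complex.sinh, Complex.cosh]
  rw [h5] at h3 ⊢
  field_simp at h4 ⊢
  linear_combination (-2 * exp (-w)) * h6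

theorem logTerm_two_cosh (f : OneForm) {w : ℂ} (hw : 0 < w.re) :
    logTerm f (2 * Complex.cosh w) =
      -2 * f.pullback (2 * Complex.cosh w) * (logCosh w - w) := by
  have h1 : x (Z (2 * Complex.cosh w)) / Z (2 * Complex.cosh w) = 1 + exp (-2 * w) := by
    rw [x_Z, Z_two_cosh hw, Complex.cosh, show -2 * w = -w - w by ring, Complex.exp_sub]
    field_simp [Complex.exp_ne_zero w]
  rw [logTerm, h1, ln_eq_log (one_add_re_pos (norm_exp_neg_two_mul_lt_one hw)), logCosh,
    OneForm.pullback]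
  ring

/-- The integral of `g` upwards over the full period `[t + a i, t + (a + 2π) i]`. -/
noncomputable def arc (a t : ℝ) (g : ℂ → ℂ) : ℂ :=
  I * ∫ θ in a..(a + 2 * Real.pi), g (t + θ * I)

theorem arc_eq_sub {a t : ℝ} {g G : ℂ → ℂ} (h : ∀ θ : ℝ, HasDerivAt G (g (t + θ * I)) (t + θ * I))
    (hg : Continuous fun θ : ℝ => g (t + θ * I)) :
    arc a t g = G (t + (a + 2 * Real.pi : ℝ) * I) - G (t + a * I) := by
  rw [arc, ← intervalIntegral.integral_const_mul]
  refine intervalIntegral.integral_eq_sub_of_hasDerivAt (f := fun θ : ℝ => G (t + θ * I))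
    (fun θ _ => ?_) ((continuous_const.mul hg).intervalIntegrable _ _)
  have h1 : HasDerivAt (fun θ : ℝ => (t : ℂ) + θ * I) I θ := by
    simpa using ((hasDerivAt_id θ).ofReal_comp.mul_const I).const_add (t : ℂ)
  exact (h θ).scomp θ h1

theorem tendsto_arc_zero {a C K : ℝ} {g : ℂ → ℂ}
    (h : ∀ᶠ t : ℝ in atTop, ∀ θ ∈ Icc a (a + 2 * Real.pi),
      ‖g (t + θ * I)‖ ≤ C * Real.exp (-t) * (t + K)) :
    Tendsto (fun t => arc a t g) atTop (𝓝 0) := by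
  have hp := Real.pi_pos
  have h1 : Tendsto (fun t : ℝ => C * Real.exp (-t) * (t + K) * (2 * Real.pi)) atTop (𝓝 0) := by
    have h2 := Real.tendsto_pow_mul_exp_neg_atTop_nhds_zero 1
    have h3 := Real.tendsto_pow_mul_exp_neg_atTop_nhds_zero 0
    have h4 := ((h2.add (h3.const_mul K)).const_mul (C * (2 * Real.pi)))
    simp only [mul_zero, add_zero] at h4
    refine h4.congr fun t => ?_
    ring
  refine squeeze_zero_norm' ?_ h1
  filter_upwards [h] with t ht
  rw [arc, norm_mul, Complex.norm_I, one_mul]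
  refine (intervalIntegral.norm_integral_le_of_norm_le_const (C := C * Real.exp (-t) * (t + K))
    fun θ hθ => ?_).trans_eq ?_
  · rw [uIoc_of_le (by linarith)] at hθ
    exact ht θ (Ioc_subset_Icc_self hθ)
  · rw [abs_of_pos (by linarith)]; ring

/-- The part of `y ^ n * ∑ p k / y ^ (k + 1)` that is not `O(y⁻²)` at infinity. -/
noncomputable def principalPart (p : ℕ → ℂ) (n : ℕ) (y : ℂ) : ℂ :=
  p n / y + ∑ k ∈ Finset.range n, p k * y ^ (n - k - 1)

/-- The definition of `principalPart` in a form that makes the size of the remainder visible. -/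
theorem principalPart_eq (p : ℕ → ℂ) (n : ℕ) {y : ℂ} (hy : y ≠ 0) :
    principalPart p n y = y ^ n * ∑ k ∈ Finset.range (n + 1), p k / y ^ (k + 1) := by
  rw [principalPart, Finset.sum_range_succ, add_comm, mul_add, Finset.mul_sum]
  congr 1
  · refine Finset.sum_congr rfl fun k hk => ?_
    have hk := Finset.mem_range.mp hk
    have h1 : y ^ n = y ^ (n - k - 1) * y ^ (k + 1) := by rw [← pow_add]; congr 1; omega
    rw [h1]; field_simp
  · rw [pow_succ]; field_simp

theorem HasExpansion.exists_bound {Q : ℂ → ℂ} {p : ℕ → ℂ} (h : HasExpansion Q p) (n : ℕ) :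
    ∃ C R : ℝ, 0 < C ∧ 0 < R ∧ ∀ y : ℂ, R < ‖y‖ →
      ‖Q y - ∑ k ∈ Finset.range (n + 1), p k / y ^ (k + 1)‖ ≤ C / ‖y‖ ^ (n + 2) := by
  obtain ⟨C, hC, hb⟩ := (h.isBigO (n + 1)).exists_pos
  obtain ⟨r, -, hr⟩ :=
    (Metric.hasBasis_cobounded_compl_closedBall (0 : ℂ)).eventually_iff.mp hb.bound
  refine ⟨C, max r 1, hC, by positivity, fun y hy => ?_⟩
  have := hr (x := y) (by simpa using (le_max_left _ _).trans_lt hy)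
  rwa [norm_inv, norm_pow, ← div_eq_mul_inv] at this

theorem re_add_mul_I (t θ : ℝ) : ((t : ℂ) + θ * I).re = t := by simp

theorem im_add_mul_I (t θ : ℝ) : ((t : ℂ) + θ * I).im = θ := by simp

theorem le_norm_two_cosh {t : ℝ} (θ : ℝ) :
    Real.exp t - Real.exp (-t) ≤ ‖2 * Complex.cosh (t + θ * I)‖ := by
  have h : 2 * Complex.cosh (t + θ * I) = exp (t + θ * I) - -exp (-(t + θ * I)) := by
    rw [Complex.cosh]; ring
  rw [h]
  refine le_trans (le_of_eq ?_) (norm_sub_norm_le _ _)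
  rw [norm_neg, Complex.norm_exp, Complex.norm_exp, Complex.neg_re, re_add_mul_I]

theorem norm_two_sinh_le {t : ℝ} (θ : ℝ) :
    ‖2 * Complex.sinh (t + θ * I)‖ ≤ Real.exp t + Real.exp (-t) := by
  have h : 2 * Complex.sinh (t + θ * I) = exp (t + θ * I) - exp (-(t + θ * I)) := by
    rw [Complex.sinh]; ring
  rw [h]
  refine (norm_sub_le _ _).trans (le_of_eq ?_)
  rw [Complex.norm_exp, Complex.norm_exp, Complex.neg_re, re_add_mul_I]

theorem tendsto_exp_sub_exp_neg :
    Tendsto (fun t : ℝ => Real.exp t - Real.exp (-t)) atTop atTop := by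
  refine tendsto_atTop_add_right_of_le' atTop (-1) Real.tendsto_exp_atTop ?_ |>.congr
    fun t => (sub_eq_add_neg _ _).symm
  filter_upwards [eventually_ge_atTop 0] with t ht
  have : Real.exp (-t) ≤ 1 := Real.exp_le_one_iff.mpr (by linarith)
  linarith

/-- A property that holds near infinity holds on all the curves `2 cosh (t + iθ)`, `t` large. -/
theorem eventually_arc {P : ℂ → Prop} (h : ∀ᶠ y in Bornology.cobounded ℂ, P y) :
    ∀ᶠ t : ℝ in atTop, ∀ θ : ℝ, P (2 * Complex.cosh (t + θ * I)) := by
  obtain ⟨r, -, hr⟩ := (Metric.hasBasis_cobounded_compl_closedBall (0 : ℂ)).eventually_iff.mp h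
  filter_upwards [tendsto_exp_sub_exp_neg.eventually_gt_atTop r] with t ht θ
  refine hr ?_
  simpa using ht.trans_le (le_norm_two_cosh θ)

/-! ### Integrals over circles in the coordinate `w` -/

/-- With `y = 2 cosh w`, `|dy/dw|` and `|y|` are both comparable to `e^t`, so what `principalPart`
leaves out of `y ^ n Q(y) dy` contributes `O(e^(-t))`. -/
theorem HasExpansion.eventually_remainder_le {Q : ℂ → ℂ} {p : ℕ → ℂ} (h : HasExpansion Q p)
    (n : ℕ) : ∃ C : ℝ, 0 < C ∧ ∀ᶠ t : ℝ in atTop, ∀ θ : ℝ,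
      ‖(Q (2 * Complex.cosh (t + θ * I)) * (2 * Complex.cosh (t + θ * I)) ^ n -
        principalPart p n (2 * Complex.cosh (t + θ * I))) * (2 * Complex.sinh (t + θ * I))‖
          ≤ C * Real.exp (-t) := by
  obtain ⟨C, R, hC, hR, hb⟩ := h.exists_bound n
  refine ⟨8 * C, by positivity, ?_⟩
  filter_upwards [tendsto_exp_sub_exp_neg.eventually_gt_atTop R, eventually_ge_atTop 1]
    with t ht ht1 θ
  have hX := ht.trans_le (le_norm_two_cosh (t := t) θ)
  have hX2 := le_norm_two_cosh (t := t) θ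
  have hS := norm_two_sinh_le (t := t) θ
  set y := 2 * Complex.cosh (t + θ * I)
  have hyp : 0 < ‖y‖ := hR.trans hX
  have hy0 : y ≠ 0 := norm_pos_iff.mp hyp
  have he : Real.exp (-t) * Real.exp t = 1 := by rw [← Real.exp_add]; simp
  have hep := Real.exp_pos (-t)
  have he2 : 2 ≤ Real.exp t := by
    have := Real.add_one_le_exp t; linarith
  have he3 : Real.exp (-t) ≤ Real.exp t / 2 := by nlinarith
  have he4 : Real.exp t / 2 ≤ ‖y‖ := by linarith
  have h1 : ‖Q y * y ^ n - principalPart p n y‖ ≤ C / ‖y‖ ^ 2 := by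
    rw [principalPart_eq p n hy0, mul_comm (Q y), ← mul_sub, norm_mul, norm_pow]
    refine (mul_le_mul_of_nonneg_left (hb y hX) (by positivity)).trans_eq ?_
    rw [pow_add]; field_simp
  rw [norm_mul]
  have h2 : C / ‖y‖ ^ 2 ≤ C / (Real.exp t / 2) ^ 2 := by gcongr
  calc _ ≤ C / (Real.exp t / 2) ^ 2 * (2 * Real.exp t) := by
        gcongr
        · exact h1.trans h2
        · linarith
    _ = 8 * C * Real.exp (-t) := by
        rw [Real.exp_neg]; field_simp; ring

theorem two_cosh_add_period (w : ℂ) (k : ℝ) :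
    2 * Complex.cosh (w + ((k + 2 * Real.pi : ℝ) : ℂ) * I) = 2 * Complex.cosh (w + k * I) := by
  have : w + ((k + 2 * Real.pi : ℝ) : ℂ) * I = w + k * I + 2 * Real.pi * I := by push_cast; ring
  rw [this]
  simp only [Complex.cosh, neg_add, Complex.exp_add, Complex.exp_two_pi_mul_I]
  rw [Complex.exp_neg (2 * _ * I), Complex.exp_two_pi_mul_I]; simp

theorem logCosh_add_period (w : ℂ) (k : ℝ) :
    logCosh (w + ((k + 2 * Real.pi : ℝ) : ℂ) * I) = logCosh (w + k * I) + 2 * Real.pi * I := by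
  have h : exp (-2 * (w + ((k + 2 * Real.pi : ℝ) : ℂ) * I)) = exp (-2 * (w + k * I)) := by
    rw [Complex.exp_eq_exp_iff_exists_int]
    exact ⟨-2, by push_cast; ring⟩
  rw [logCosh, logCosh, h]; push_cast; ring

theorem hasDerivAt_two_cosh (w : ℂ) :
    HasDerivAt (fun w => 2 * Complex.cosh w) (2 * Complex.sinh w) w :=
  (Complex.hasDerivAt_cosh w).const_mul 2

theorem hasDerivAt_pow_div {m : ℕ} (hm : 0 < m) (w : ℂ) :
    HasDerivAt (fun w => (2 * Complex.cosh w) ^ m / m)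
      ((2 * Complex.cosh w) ^ (m - 1) * (2 * Complex.sinh w)) w := by
  have h0 : (m : ℂ) ≠ 0 := Nat.cast_ne_zero.mpr hm.ne'
  refine (((hasDerivAt_two_cosh w).pow m).div_const (m : ℂ)).congr_deriv ?_
  field_simp

theorem hasDerivAt_primitive (p : ℕ → ℂ) (n : ℕ) {w : ℂ} (hw : 0 < w.re) :
    HasDerivAt (fun w => p n * logCosh w +
        ∑ k ∈ Finset.range n, p k * ((2 * Complex.cosh w) ^ (n - k) / (n - k : ℕ)))
      (principalPart p n (2 * Complex.cosh w) * (2 * Complex.sinh w)) w := by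
  refine (((hasDerivAt_logCosh hw).const_mul (p n)).add (HasDerivAt.fun_sum fun k hk =>
    (hasDerivAt_pow_div (Nat.sub_pos_of_lt (Finset.mem_range.mp hk)) w).const_mul
      (p k))).congr_deriv ?_
  rw [principalPart, add_mul, Finset.sum_mul]
  congr 1
  · ring
  · exact Finset.sum_congr rfl fun k _ => by ring

theorem hasDerivAt_primitive_log (p : ℕ → ℂ) (n : ℕ) {w : ℂ} (hw : 0 < w.re) :
    HasDerivAt (fun w => p n * (logCosh w ^ 2 / 2) + ∑ k ∈ Finset.range n,
        p k * ((2 * Complex.cosh w) ^ (n - k) / (n - k : ℕ) * logCosh w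
          - (2 * Complex.cosh w) ^ (n - k) / (n - k : ℕ) / (n - k : ℕ)))
      (principalPart p n (2 * Complex.cosh w) * (2 * Complex.sinh w) * logCosh w) w := by
  have hl := hasDerivAt_logCosh hw
  refine ((((hl.pow 2).div_const 2).const_mul (p n)).add (HasDerivAt.fun_sum fun k hk => by
    have hd := hasDerivAt_pow_div (Nat.sub_pos_of_lt (Finset.mem_range.mp hk)) w
    exact ((hd.mul hl).sub (hd.div_const _)).const_mul (p k))).congr_deriv ?_
  rw [principalPart, add_mul, add_mul, Finset.sum_mul, Finset.sum_mul]
  congr 1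
  · simp; ring
  · refine Finset.sum_congr rfl fun k hk => ?_
    have hm := Nat.sub_pos_of_lt (Finset.mem_range.mp hk)
    have h0 : ((n - k : ℕ) : ℂ) ≠ 0 := Nat.cast_ne_zero.mpr hm.ne'
    have hX := two_cosh_ne_zero hw
    have h1 : (2 * Complex.cosh w) ^ (n - k) =
      (2 * Complex.cosh w) ^ (n - k - 1) * (2 * Complex.cosh w) := by
      rw [← pow_succ]; congr 1; omega
    rw [h1]
    generalize 2 * Complex.cosh w = X at *
    generalize 2 * Complex.sinh w = S
    field_simp
    ring

theorem arc_sub {a t : ℝ} {g h : ℂ → ℂ} (hg : Continuous fun θ : ℝ => g (t + θ * I))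
    (hh : Continuous fun θ : ℝ => h (t + θ * I)) :
    arc a t (fun w => g w - h w) = arc a t g - arc a t h := by
  rw [arc, arc, arc, ← mul_sub, ← intervalIntegral.integral_sub
    (hg.intervalIntegrable _ _) (hh.intervalIntegrable _ _)]

theorem continuous_logCosh_arc {t : ℝ} (ht : 0 < t) :
    Continuous fun θ : ℝ => logCosh (t + θ * I) := by
  refine continuous_iff_continuousAt.mpr fun θ => ?_
  have h : ContinuousAt logCosh (t + θ * I) :=
    (hasDerivAt_logCosh (by rwa [re_add_mul_I])).continuousAt
  exact ContinuousAt.comp (f := fun θ : ℝ => (t : ℂ) + θ * I) h (by fun_prop)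

theorem continuous_principalPart_arc (p : ℕ → ℂ) (n : ℕ) {t : ℝ} (ht : 0 < t) :
    Continuous fun θ : ℝ => principalPart p n (2 * Complex.cosh (t + θ * I)) := by
  have h : ∀ θ : ℝ, 2 * Complex.cosh (t + θ * I) ≠ 0 := fun θ =>
    two_cosh_ne_zero (by rwa [re_add_mul_I])
  unfold principalPart
  refine Continuous.add (continuous_const.div (by fun_prop) h) (by fun_prop)

theorem HasExpansion.eventually_continuous_arc {Q : ℂ → ℂ} {p : ℕ → ℂ} (h : HasExpansion Q p) :
    ∀ᶠ t : ℝ in atTop, Continuous fun θ : ℝ => Q (2 * Complex.cosh (t + θ * I)) := by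
  filter_upwards [eventually_arc h.eventually_continuousAt] with t ht
  exact continuous_iff_continuousAt.mpr fun θ =>
    ContinuousAt.comp (f := fun θ : ℝ => 2 * Complex.cosh (t + θ * I)) (ht θ) (by fun_prop)

/-- The coefficients of an expansion as limits of integrals in the coordinate `w = log z`. -/
theorem HasExpansion.tendsto_arc {Q : ℂ → ℂ} {p : ℕ → ℂ} (h : HasExpansion Q p) (n : ℕ) (a : ℝ) :
    Tendsto (fun t => arc a t fun w =>
      Q (2 * Complex.cosh w) * (2 * Complex.cosh w) ^ n * (2 * Complex.sinh w))
      atTop (𝓝 (2 * Real.pi * I * p n)) := by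
  obtain ⟨C, hC, hb⟩ := h.eventually_remainder_le n
  have h0 : Tendsto (fun t => arc a t fun w => (Q (2 * Complex.cosh w) *
      (2 * Complex.cosh w) ^ n - principalPart p n (2 * Complex.cosh w)) * (2 * Complex.sinh w))
      atTop (𝓝 0) := by
    refine tendsto_arc_zero (C := C) (K := 0) ?_
    filter_upwards [hb, eventually_ge_atTop 1] with t ht ht1 θ _
    refine (ht θ).trans (le_mul_of_one_le_right (by positivity) (by linarith))
  have h1 := h0.add_const (2 * Real.pi * I * p n)
  rw [zero_add] at h1
  refine h1.congr' ?_
  filter_upwards [eventually_gt_atTop 0, h.eventually_continuous_arc] with t ht hc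
  have hp := continuous_principalPart_arc p n ht
  simp only [sub_mul]
  rw [arc_sub ((hc.mul (by fun_prop)).mul (by fun_prop)) (by fun_prop), arc_eq_sub
    (g := fun w => principalPart p n (2 * Complex.cosh w) * (2 * Complex.sinh w))
    (fun θ => hasDerivAt_primitive p n (by rwa [re_add_mul_I])) (by fun_prop)]
  simp only [two_cosh_add_period, logCosh_add_period]
  ring

theorem norm_logCosh_le {t : ℝ} (ht : 1 ≤ t) (θ : ℝ) : ‖logCosh (t + θ * I)‖ ≤ t + (|θ| + 1) := by
  have h1 : ‖exp (-2 * (t + θ * I))‖ ≤ 1 / 2 := by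
    have h2 : (-2 * ((t : ℂ) + θ * I)).re = -(2 * t) := by simp
    rw [Complex.norm_exp, h2, Real.exp_neg]
    rw [one_div]
    refine inv_anti₀ two_pos ?_
    have := Real.add_one_le_exp (2 * t); linarith
  rw [logCosh]
  refine (norm_add_le _ _).trans ?_
  have h3 := Complex.norm_log_one_add_half_le_self h1
  have h4 : ‖(t : ℂ) + θ * I‖ ≤ t + |θ| := by
    refine (norm_add_le _ _).trans ?_
    simp [abs_of_nonneg (zero_le_one.trans ht)]
  linarith

/-- With the logarithm `logCosh w = log y` as a weight, the terms of the expansion of order at least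
`y ^ (-n-1)` give boundary terms instead of a single coefficient: the primitives of
`y ^ (m-1) log y` and of `y⁻¹ log y` increase over the period because `log y` does. -/
theorem HasExpansion.tendsto_arc_log {Q : ℂ → ℂ} {p : ℕ → ℂ} (h : HasExpansion Q p) (n : ℕ)
    (a : ℝ) :
    Tendsto (fun t : ℝ => arc a t (fun w =>
        Q (2 * Complex.cosh w) * (2 * Complex.cosh w) ^ n * (2 * Complex.sinh w) * logCosh w) -
      2 * Real.pi * I * (p n * (logCosh (t + a * I) + Real.pi * I) + ∑ k ∈ Finset.range n,
        p k * ((2 * Complex.cosh (t + a * I)) ^ (n - k) / (n - k : ℕ)))) atTop (𝓝 0) := by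
  obtain ⟨C, hC, hb⟩ := h.eventually_remainder_le n
  have h0 : Tendsto (fun t => arc a t fun w => (Q (2 * Complex.cosh w) *
      (2 * Complex.cosh w) ^ n - principalPart p n (2 * Complex.cosh w)) * (2 * Complex.sinh w) *
        logCosh w) atTop (𝓝 0) := by
    refine tendsto_arc_zero (C := C) (K := |a| + |a + 2 * Real.pi| + 1) ?_
    filter_upwards [hb, eventually_ge_atTop 1] with t ht ht1 θ hθ
    rw [norm_mul]
    have h2 := norm_logCosh_le ht1 θ
    have h3 : |θ| ≤ |a| + |a + 2 * Real.pi| := by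
      have := abs_le_max_abs_abs hθ.1 hθ.2
      exact this.trans (max_le_add_of_nonneg (abs_nonneg _) (abs_nonneg _))
    have h4 := ht θ
    gcongr
    linarith
  refine h0.congr' ?_
  filter_upwards [eventually_gt_atTop 0, h.eventually_continuous_arc] with t ht hc
  have hp := continuous_principalPart_arc p n ht
  have hl := continuous_logCosh_arc ht
  simp only [sub_mul]
  rw [arc_sub (((hc.mul (by fun_prop)).mul (by fun_prop)).mul hl) (by fun_prop), arc_eq_sub
    (g := fun w => principalPart p n (2 * Complex.cosh w) * (2 * Complex.sinh w) * logCosh w)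
    (fun θ => hasDerivAt_primitive_log p n (by rwa [re_add_mul_I])) (by fun_prop)]
  simp only [two_cosh_add_period, logCosh_add_period]
  congr 1
  rw [add_sub_add_comm, ← Finset.sum_sub_distrib, mul_add, Finset.mul_sum]
  congr 1
  · ring
  · exact Finset.sum_congr rfl fun k _ => by ring

/-- The coefficients of the pullback of `f` are the numbers `n! 𝓘¹_{n-1}[f]`. -/
theorem factorial_mul_I1Pred {f : OneForm} {p : ℕ → ℂ} (h : HasExpansion f.pullback p)
    (h0 : p 0 = 0) (n : ℕ) : n.factorial * I1Pred f n = p n := by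
  cases n with
  | zero => simp [I1Pred, h0]
  | succ b =>
    have hf : ((b + 1).factorial : ℂ) ≠ 0 := Nat.cast_ne_zero.mpr (Nat.factorial_ne_zero _)
    have key : residueInfty (fun z => x z ^ (b + 1) / (b + 1).factorial * f.coeff z) =
        -(p (b + 1) / (b + 1).factorial) := by
      refine Tendsto.limUnder_eq ?_
      have h1 := ((h.tendsto_arc (b + 1) (-(2 * Real.pi))).div_const
        (((b + 1).factorial : ℂ))).const_mul (-(2 * Real.pi * I)⁻¹)
      have h2 : Tendsto (fun r : ℝ => -Real.log r) (𝓝[>] 0) atTop :=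
        tendsto_neg_atBot_atTop.comp Real.tendsto_log_nhdsGT_zero
      have h3 := h1.comp h2
      have h4 : -(2 * Real.pi * I)⁻¹ * (2 * Real.pi * I * p (b + 1) / (b + 1).factorial) =
          -(p (b + 1) / (b + 1).factorial) := by
        have := Complex.two_pi_I_ne_zero
        field_simp
      rw [h4] at h3
      refine h3.congr' ?_
      filter_upwards [self_mem_nhdsWithin, Ioo_mem_nhdsGT (zero_lt_one' ℝ)] with r hr hr1
      have hr : 0 < r := hr
      have ht : 0 < -Real.log r := by have := Real.log_neg hr hr1.2; linarith
      simp only [Function.comp]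
      rw [neg_mul, ← mul_neg]
      congr 1
      rw [arc, circleIntegral, mul_div_assoc, ← intervalIntegral.integral_div,
        ← intervalIntegral.integral_const_mul, ← intervalIntegral.integral_neg]
      have h5 := intervalIntegral.integral_comp_neg (a := 0) (b := 2 * Real.pi) (fun θ : ℝ =>
        -(I * ((fun w => f.pullback (2 * Complex.cosh w) * (2 * Complex.cosh w) ^ (b + 1) *
          (2 * Complex.sinh w)) ((-Real.log r : ℝ) + θ * I) / ((b + 1).factorial : ℂ))))
      rw [neg_zero] at h5
      rw [neg_add_cancel, ← h5]
      refine intervalIntegral.integral_congr fun θ _ => ?_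
      -- the circle of radius `r` around `w = 0` is the circle of radius `1/r` in `z`, reversed
      have h6 : circleMap 0 r θ = (exp ((-Real.log r : ℝ) + (-θ : ℝ) * I))⁻¹ := by
        rw [← Complex.exp_neg, circleMap, zero_add]
        conv_lhs => rw [← Real.exp_log hr]
        push_cast
        rw [← Complex.exp_add]; congr 1; ring
      have h7 := pullback_two_cosh f (w := (-Real.log r : ℝ) + (-θ : ℝ) * I)
        (by rwa [re_add_mul_I])
      simp only [deriv_circleMap, smul_eq_mul]
      rw [h6, inv_inv]
      generalize ((-Real.log r : ℝ) : ℂ) + (-θ : ℝ) * I = w at *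
      rw [x_exp, mul_right_comm, h7]
      field_simp [Complex.exp_ne_zero w]
    rw [I1Pred, I1, key]
    field_simp

/-! ### The integrands on the two imaginary rays -/

/-- For `s = ± i`, the point `Z (s u)` of the imaginary axis, made continuous up to the cut of `Z`
at `u = 0`. -/
noncomputable def rayPoint (s : ℂ) (u : ℝ) : ℂ := s * ((u + √(u ^ 2 + 4)) / 2 : ℝ)

/-- The restriction of `f.pullback` to the ray `s u`, `u > 0`, continued to all real `u`. -/
noncomputable def OneForm.rayPullback (f : OneForm) (s : ℂ) (u : ℝ) : ℂ :=
  f.coeff (rayPoint s u) / dx (rayPoint s u)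

theorem rayRadius_pos (u : ℝ) : 0 < (u + √(u ^ 2 + 4)) / 2 := by
  have h : |u| < √(u ^ 2 + 4) := by
    rw [← Real.sqrt_sq_eq_abs]
    exact Real.sqrt_lt_sqrt (sq_nonneg u) (by linarith)
  have := (abs_lt.mp h).1
  linarith

theorem dx_mul_ofReal_ne_zero {s : ℂ} (hs : s ^ 2 = -1) {r : ℝ} (hr : 0 < r) :
    dx (s * r) ≠ 0 := by
  have h1 : dx (s * r) = ((1 + (r ^ 2)⁻¹ : ℝ) : ℂ) := by
    rw [dx, mul_pow, hs]; push_cast; rw [neg_one_mul, inv_neg, sub_neg_eq_add]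
  rw [h1]
  exact_mod_cast (by positivity : (0 : ℝ) < 1 + (r ^ 2)⁻¹).ne'

theorem Z_ray {s : ℂ} (hs : s ^ 2 = -1) {u : ℝ} (hu : 0 < u) : Z (s * u) = rayPoint s u := by
  have hr := rayRadius_pos u
  have hsq := Real.sq_sqrt (show 0 ≤ u ^ 2 + 4 by positivity)
  have hs0 : s ≠ 0 := by rintro rfl; norm_num at hs
  have hn : ‖s‖ = 1 := by
    have h1 : ‖s‖ ^ 2 = 1 := by rw [← norm_pow, hs]; simp
    nlinarith [norm_nonneg s]
  have hr1 : 1 < (u + √(u ^ 2 + 4)) / 2 := by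
    have : 2 < √(u ^ 2 + 4) := Real.lt_sqrt_of_sq_lt (by nlinarith)
    linarith
  have hx : x (rayPoint s u) = s * u := by
    rw [x, rayPoint]
    set r := (u + √(u ^ 2 + 4)) / 2 with hrdef
    have h2 : r ^ 2 - u * r - 1 = 0 := by rw [hrdef]; nlinarith
    have h3 : (r : ℂ) ^ 2 - u * r - 1 = 0 := by exact_mod_cast h2
    have h4 : (r : ℂ) ≠ 0 := by exact_mod_cast hr.ne'
    field_simp
    linear_combination (s ^ 2) * h3 + hs
  rw [← hx, Z_x]
  rw [rayPoint, norm_mul, hn, one_mul, Complex.norm_real, Real.norm_of_nonneg hr.le]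
  exact hr1

theorem pullback_ray (f : OneForm) {s : ℂ} (hs : s ^ 2 = -1) {u : ℝ} (hu : 0 < u) :
    f.pullback (s * u) = f.rayPullback s u := by
  rw [OneForm.pullback, OneForm.rayPullback, Z_ray hs hu]

theorem re_eq_zero_of_sq {s : ℂ} (hs : s ^ 2 = -1) : s.re = 0 := by
  have h1 : (s - I) * (s + I) = 0 := by
    have := Complex.I_sq
    linear_combination hs - this
  rcases mul_eq_zero.mp h1 with h | h
  · rw [sub_eq_zero.mp h]; simp
  · rw [eq_neg_of_add_eq_zero_left h]; simp

theorem norm_eq_one_of_sq {s : ℂ} (hs : s ^ 2 = -1) : ‖s‖ = 1 := by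
  have h1 : ‖s‖ ^ 2 = 1 := by rw [← norm_pow, hs]; simp
  nlinarith [norm_nonneg s]

theorem continuous_rayPullback {f : OneForm} (him : ∀ a : ℂ, a.re = 0 → ¬ f.IsPole a) {s : ℂ}
    (hs : s ^ 2 = -1) : Continuous (f.rayPullback s) := by
  have hc : Continuous (rayPoint s) := by unfold rayPoint; fun_prop
  have hs0 : s ≠ 0 := by rintro rfl; norm_num at hs
  have hne : ∀ u, rayPoint s u ≠ 0 := fun u =>
    mul_ne_zero hs0 (by exact_mod_cast (rayRadius_pos u).ne')
  refine Continuous.div ?_ ?_ fun u => dx_mul_ofReal_ne_zero hs (rayRadius_pos u)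
  · refine continuous_iff_continuousAt.mpr fun u => ?_
    refine ContinuousAt.comp (f := rayPoint s) ?_ hc.continuousAt
    exact (analyticAt_coeff (him _ (by simp [rayPoint, re_eq_zero_of_sq hs]))).continuousAt
  · unfold dx
    exact continuous_const.sub ((hc.pow 2).inv₀ fun u => pow_ne_zero _ (hne u))

/-- `𝓡_b[f]` is the remainder of the expansion of `f.pullback`; the shift of the index is harmless
since `p 0 = 0`. -/
theorem R_eq {f : OneForm} {p : ℕ → ℂ} (hp : ∀ n : ℕ, n.factorial * I1Pred f n = p n) (b : ℕ)
    (y : ℂ) : R f b y = f.pullback y - ∑ k ∈ Finset.range (b + 1), p k / y ^ (k + 1) := by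
  have h0 : p 0 = 0 := by rw [← hp]; simp [I1Pred]
  rw [R, OneForm.pullback, Finset.sum_range_succ', h0, zero_div, add_zero]
  congr 1
  refine Finset.sum_congr rfl fun a _ => ?_
  rw [← hp, I1Pred]; ring

/-- The integrand in terms of the continuous function `rayPullback`, and of the coefficients
`p k = k! 𝓘¹_{k-1}` of the expansion of `f.pullback`. -/
theorem rayIntegrand_eq {f : OneForm} {p : ℕ → ℂ} (hp : ∀ n : ℕ, n.factorial * I1Pred f n = p n)
    (b : ℕ) {s : ℂ} (hs : s ^ 2 = -1) {ε u : ℝ} (hu : 0 < u + ε) :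
    b.factorial * rayIntegrand f b ε s u = (s * u) ^ b * f.rayPullback s (u + ε) * s -
      ∑ k ∈ Finset.range (b + 1), p k * s ^ (b - k) * (u ^ b / (u + ε) ^ (k + 1) : ℝ) := by
  have hf : (b.factorial : ℂ) ≠ 0 := Nat.cast_ne_zero.mpr (Nat.factorial_ne_zero _)
  have hs0 : s ≠ 0 := by rintro rfl; norm_num at hs
  have hue : ((u + ε : ℝ) : ℂ) ≠ 0 := by exact_mod_cast hu.ne'
  have h1 : s * u + s * ε = s * ((u + ε : ℝ) : ℂ) := by push_cast; ring
  rw [rayIntegrand, h1, R_eq hp, pullback_ray f hs hu, mul_sub, sub_mul, mul_sub]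
  congr 1
  · field_simp
  · rw [Finset.mul_sum, Finset.sum_mul, Finset.mul_sum]
    refine Finset.sum_congr rfl fun k hk => ?_
    have hk : k ≤ b := Nat.lt_succ_iff.mp (Finset.mem_range.mp hk)
    have h2 : s ^ b = s ^ (b - k) * s ^ k := by rw [← pow_add]; congr 1; omega
    rw [Complex.ofReal_div, Complex.ofReal_pow, Complex.ofReal_pow, mul_pow, mul_pow, h2]
    generalize ((u + ε : ℝ) : ℂ) = v at *
    field_simp
    ring

theorem continuousOn_rayIntegrand {f : OneForm} (him : ∀ a : ℂ, a.re = 0 → ¬ f.IsPole a)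
    (b : ℕ) {s : ℂ} (hs : s ^ 2 = -1) (ε : ℝ) :
    ContinuousOn (rayIntegrand f b ε s) {u | 0 < u + ε} := by
  have hf : (b.factorial : ℂ) ≠ 0 := Nat.cast_ne_zero.mpr (Nat.factorial_ne_zero _)
  have hc := continuous_rayPullback him hs
  have h1 : ContinuousOn (fun u : ℝ => ((b.factorial : ℂ))⁻¹ *
      ((s * u) ^ b * f.rayPullback s (u + ε) * s - ∑ k ∈ Finset.range (b + 1),
        (k.factorial * I1Pred f k) * s ^ (b - k) * (u ^ b / (u + ε) ^ (k + 1) : ℝ)))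
      {u | 0 < u + ε} := by
    refine continuousOn_const.mul (ContinuousOn.sub ?_ ?_)
    · exact (Continuous.mul (Continuous.mul (by fun_prop) (by fun_prop))
        continuous_const).continuousOn
    · refine continuousOn_finsetSum _ fun k _ => continuousOn_const.mul ?_
      refine Complex.continuous_ofReal.comp_continuousOn ?_
      refine ContinuousOn.div (by fun_prop) (by fun_prop) fun u hu => ?_
      have hu : 0 < u + ε := hu
      positivity
  refine h1.congr fun u hu => ?_
  rw [eq_inv_mul_iff_mul_eq₀ hf, rayIntegrand_eq (fun _ => rfl) b hs hu]

/-- Decay of the integrand at infinity, uniformly in `ε`. -/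
theorem exists_rayIntegrand_bound {f : OneForm} {p : ℕ → ℂ} (h : HasExpansion f.pullback p)
    (hp : ∀ n : ℕ, n.factorial * I1Pred f n = p n) (b : ℕ) :
    ∃ C U₀ : ℝ, 0 < C ∧ 0 < U₀ ∧ ∀ s : ℂ, s ^ 2 = -1 → ∀ ε u : ℝ, 0 ≤ ε → U₀ < u →
      ‖rayIntegrand f b ε s u‖ ≤ C * u ^ (-2 : ℝ) := by
  obtain ⟨C, U₀, hC, hU, hb⟩ := h.exists_bound b
  refine ⟨C, U₀, hC, hU, fun s hs ε u hε hu => ?_⟩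
  have hn := norm_eq_one_of_sq hs
  have hu0 : 0 < u := hU.trans hu
  have h1 : s * u + s * ε = s * ((u + ε : ℝ) : ℂ) := by push_cast; ring
  have h2 : ‖s * ((u + ε : ℝ) : ℂ)‖ = u + ε := by
    rw [norm_mul, hn, one_mul, Complex.norm_real, Real.norm_of_nonneg (by linarith)]
  have h3 := hb (s * ((u + ε : ℝ) : ℂ)) (by rw [h2]; linarith)
  rw [h2, ← R_eq hp] at h3
  have h4 : (1 : ℝ) ≤ b.factorial := by exact_mod_cast Nat.factorial_pos b
  rw [rayIntegrand, h1, norm_mul, norm_mul, norm_div, norm_pow, norm_mul, hn, one_mul, mul_one,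
    Complex.norm_real, Real.norm_of_nonneg hu0.le, Complex.norm_natCast]
  calc u ^ b / b.factorial * ‖R f b (s * ((u + ε : ℝ) : ℂ))‖
      ≤ u ^ b / 1 * (C / u ^ (b + 2)) := by
        gcongr
        refine h3.trans ?_
        gcongr
        linarith
    _ = C * u ^ (-2 : ℝ) := by
        rw [Real.rpow_neg hu0.le, Real.rpow_two, pow_add]; field_simp

theorem integrableOn_rayIntegrand_tail {f : OneForm} (him : ∀ a : ℂ, a.re = 0 → ¬ f.IsPole a)
    (b : ℕ) {s : ℂ} (hs : s ^ 2 = -1) {ε C U : ℝ} (hε : 0 ≤ ε) (hU : 0 < U)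
    (hb : ∀ u, U < u → ‖rayIntegrand f b ε s u‖ ≤ C * u ^ (-2 : ℝ)) :
    MeasureTheory.IntegrableOn (rayIntegrand f b ε s) (Ioi U) := by
  refine MeasureTheory.Integrable.mono'
    ((integrableOn_Ioi_rpow_of_lt (by norm_num : (-2 : ℝ) < -1) hU).const_mul C) ?_ ?_
  · refine ((continuousOn_rayIntegrand him b hs ε).mono fun u hu => ?_).aestronglyMeasurable
      measurableSet_Ioi
    have hu : U < u := hu
    show 0 < u + ε
    linarith
  · exact (MeasureTheory.ae_restrict_mem measurableSet_Ioi).mono fun u hu => hb u hu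

theorem intervalIntegrable_rayIntegrand {f : OneForm} (him : ∀ a : ℂ, a.re = 0 → ¬ f.IsPole a)
    (b : ℕ) {s : ℂ} (hs : s ^ 2 = -1) {ε U : ℝ} (hε : 0 < ε) (hU : 0 < U) :
    IntervalIntegrable (rayIntegrand f b ε s) MeasureTheory.volume 0 U := by
  refine ((continuousOn_rayIntegrand him b hs ε).mono fun u hu => ?_).intervalIntegrable
  rw [uIcc_of_le hU.le] at hu
  show 0 < u + ε
  linarith [hu.1]

theorem integrableOn_rayIntegrand {f : OneForm} (him : ∀ a : ℂ, a.re = 0 → ¬ f.IsPole a)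
    {p : ℕ → ℂ} (h : HasExpansion f.pullback p)
    (hp : ∀ n : ℕ, n.factorial * I1Pred f n = p n) (b : ℕ) {s : ℂ} (hs : s ^ 2 = -1)
    {ε : ℝ} (hε : 0 < ε) :
    MeasureTheory.IntegrableOn (rayIntegrand f b ε s) (Ioi 0) := by
  obtain ⟨C, U, hC, hU, hb⟩ := exists_rayIntegrand_bound h hp b
  rw [← Ioc_union_Ioi_eq_Ioi hU.le]
  refine MeasureTheory.IntegrableOn.union ?_
    (integrableOn_rayIntegrand_tail him b hs hε.le hU fun u => hb s hs ε u hε.le)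
  exact (intervalIntegrable_iff_integrableOn_Ioc_of_le hU.le).mp
    (intervalIntegrable_rayIntegrand him b hs hε hU)

/-- The regularised integrals `∫₀^U u ^ n / (u + ε) ^ (k + 1)` converge when `k < n`. -/
theorem tendsto_integral_pow_div {n k : ℕ} (hk : k < n) {U : ℝ} (hU : 0 < U) :
    Tendsto (fun ε : ℝ => ∫ u in (0 : ℝ)..U, u ^ n / (u + ε) ^ (k + 1)) (𝓝[>] 0)
      (𝓝 (U ^ (n - k) / (n - k : ℕ))) := by
  have h1 : ∫ u in (0 : ℝ)..U, u ^ (n - k - 1) = U ^ (n - k) / (n - k : ℕ) := by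
    have h2 : n - k - 1 + 1 = n - k := by omega
    rw [integral_pow, h2, zero_pow (by omega), sub_zero]
    congr 1; exact_mod_cast h2
  have hpow : ∀ u : ℝ, u ^ n = u ^ (n - k - 1) * u ^ (k + 1) := fun u => by
    rw [← pow_add]; congr 1; omega
  rw [← h1]
  refine intervalIntegral.tendsto_integral_filter_of_dominated_convergence
    (fun u => u ^ (n - k - 1)) ?_ ?_ ?_ ?_
  · filter_upwards with ε
    exact (Measurable.aestronglyMeasurable (by fun_prop))
  · filter_upwards [self_mem_nhdsWithin] with ε hε
    filter_upwards with u hu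
    have hε : 0 < ε := hε
    rw [uIoc_of_le hU.le] at hu
    have hu0 := hu.1
    rw [Real.norm_of_nonneg (by positivity), hpow, mul_div_assoc]
    refine mul_le_of_le_one_right (by positivity) ?_
    rw [div_le_one (by positivity)]
    gcongr
    linarith
  · exact (continuous_pow _).intervalIntegrable _ _
  · filter_upwards with u hu
    rw [uIoc_of_le hU.le] at hu
    have hu0 := hu.1
    have h3 : Tendsto (fun ε : ℝ => u ^ n / (u + ε) ^ (k + 1)) (𝓝 0)
        (𝓝 (u ^ n / (u + 0) ^ (k + 1))) := by
      have : ContinuousAt (fun ε : ℝ => u ^ n / (u + ε) ^ (k + 1)) 0 :=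
        continuousAt_const.div (by fun_prop) (by rw [add_zero]; positivity)
      exact this
    have h4 : u ^ n / (u + 0) ^ (k + 1) = u ^ (n - k - 1) := by
      rw [add_zero, hpow, mul_div_assoc, div_self (by positivity), mul_one]
    rw [h4] at h3
    exact h3.mono_left nhdsWithin_le_nhds

/-- The logarithmically divergent integral: the primitive of `u ^ n / (u + ε) ^ (n + 1)` is
`log (u + ε) - ∑ (u / (u + ε)) ^ j / j`, which produces the harmonic number. -/
theorem integral_pow_div_pow_succ (n : ℕ) {U ε : ℝ} (hU : 0 < U) (hε : 0 < ε) :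
    ∫ u in (0 : ℝ)..U, u ^ n / (u + ε) ^ (n + 1) =
      Real.log (U + ε) - Real.log ε -
        ∑ j ∈ Finset.range n, (U / (U + ε)) ^ (j + 1) / (j + 1 : ℕ) := by
  have hd : ∀ u ∈ uIcc 0 U, HasDerivAt (fun u : ℝ => Real.log (u + ε) -
      ∑ j ∈ Finset.range n, (u / (u + ε)) ^ (j + 1) / (j + 1 : ℕ))
      (u ^ n / (u + ε) ^ (n + 1)) u := by
    intro u hu
    rw [uIcc_of_le hU.le] at hu
    have h0 : 0 < u + ε := by linarith [hu.1]
    have h1 : HasDerivAt (fun u : ℝ => u + ε) 1 u := (hasDerivAt_id u).add_const ε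
    have h2 : HasDerivAt (fun u : ℝ => u / (u + ε)) (ε / (u + ε) ^ 2) u :=
      ((hasDerivAt_id u).div h1 h0.ne').congr_deriv (by simp)
    refine ((h1.log h0.ne').sub (HasDerivAt.fun_sum fun j _ =>
      (h2.pow (j + 1)).div_const ((j + 1 : ℕ) : ℝ))).congr_deriv ?_
    have h3 : ∀ j : ℕ, ((j + 1 : ℕ) : ℝ) * (u / (u + ε)) ^ (j + 1 - 1) * (ε / (u + ε) ^ 2) /
        ((j + 1 : ℕ) : ℝ) = (u / (u + ε)) ^ j * (ε / (u + ε) ^ 2) := fun j => by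
      have : ((j + 1 : ℕ) : ℝ) ≠ 0 := Nat.cast_ne_zero.mpr (Nat.succ_ne_zero j)
      rw [Nat.add_sub_cancel]; field_simp
    rw [Finset.sum_congr rfl fun j _ => h3 j, ← Finset.sum_mul]
    have h4 : (∑ j ∈ Finset.range n, (u / (u + ε)) ^ j) * (1 - u / (u + ε)) =
        1 - (u / (u + ε)) ^ n := by
      have := geom_sum_mul (u / (u + ε)) n
      linarith
    have h5 : ε / (u + ε) ^ 2 = (1 - u / (u + ε)) * (1 / (u + ε)) := by field_simp; ring
    rw [h5, ← mul_assoc, h4, div_pow, pow_succ]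
    field_simp
    ring
  rw [intervalIntegral.integral_eq_sub_of_hasDerivAt hd]
  · simp
    ring
  · refine ContinuousOn.intervalIntegrable (ContinuousOn.div (by fun_prop) (by fun_prop) ?_)
    intro u hu
    rw [uIcc_of_le hU.le] at hu
    have h0 : 0 < u + ε := by linarith [hu.1]
    positivity

theorem tendsto_integral_pow_div_log (n : ℕ) {U : ℝ} (hU : 0 < U) :
    Tendsto (fun ε : ℝ => (∫ u in (0 : ℝ)..U, u ^ n / (u + ε) ^ (n + 1)) + Real.log ε) (𝓝[>] 0)
      (𝓝 (Real.log U - (harmonic n : ℝ))) := by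
  have h1 : ContinuousAt (fun ε : ℝ => Real.log (U + ε) -
      ∑ j ∈ Finset.range n, (U / (U + ε)) ^ (j + 1) / (j + 1 : ℕ)) 0 := by
    have : U + 0 ≠ 0 := by linarith
    fun_prop (disch := assumption)
  have h2 : Real.log (U + 0) - ∑ j ∈ Finset.range n, (U / (U + 0)) ^ (j + 1) / (j + 1 : ℕ) =
      Real.log U - (harmonic n : ℝ) := by
    rw [add_zero, div_self hU.ne', harmonic]
    push_cast
    simp
  have h3 := h1.tendsto
  rw [h2] at h3
  refine (h3.mono_left nhdsWithin_le_nhds).congr' ?_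
  filter_upwards [self_mem_nhdsWithin] with ε hε
  rw [integral_pow_div_pow_succ n hU hε]; ring

/-! ### Convergence of the regularised integrals -/

/-- The finite part, up to a factor `b!`, of the integral along the ray `s u`, `u > 0`, of
`x ^ b / b! 𝓡_b[f]`, where `p` is the expansion of `f.pullback`. The singular terms of `R f b` are
split off below the cut point `u = U`, on whose choice the value does not depend. -/
noncomputable def rayFinitePart (f : OneForm) (p : ℕ → ℂ) (b : ℕ) (s : ℂ) (U : ℝ) : ℂ :=
  (∫ u in (0 : ℝ)..U, (s * u) ^ b * f.rayPullback s u * s) -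
    ∑ k ∈ Finset.range b, p k * ((s * U) ^ (b - k) / (b - k : ℕ)) -
    p b * (Real.log U - (harmonic b : ℂ)) +
    b.factorial * ∫ u in Ioi U, rayIntegrand f b 0 s u

theorem tendsto_integral_tail {f : OneForm} (him : ∀ a : ℂ, a.re = 0 → ¬ f.IsPole a)
    (b : ℕ) {s : ℂ} (hs : s ^ 2 = -1) {C U : ℝ} (hU : 0 < U)
    (hb : ∀ ε u : ℝ, 0 ≤ ε → U < u → ‖rayIntegrand f b ε s u‖ ≤ C * u ^ (-2 : ℝ)) :
    Tendsto (fun ε : ℝ => ∫ u in Ioi U, rayIntegrand f b ε s u) (𝓝[>] 0)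
      (𝓝 (∫ u in Ioi U, rayIntegrand f b 0 s u)) := by
  refine MeasureTheory.tendsto_integral_filter_of_dominated_convergence
    (fun u => C * u ^ (-2 : ℝ)) ?_ ?_
    ((integrableOn_Ioi_rpow_of_lt (by norm_num : (-2 : ℝ) < -1) hU).const_mul C) ?_
  · filter_upwards [self_mem_nhdsWithin] with ε hε
    have hε : 0 < ε := hε
    exact (integrableOn_rayIntegrand_tail him b hs hε.le hU fun u => hb ε u hε.le).1
  · filter_upwards [self_mem_nhdsWithin] with ε hε
    have hε : 0 < ε := hε
    exact (MeasureTheory.ae_restrict_mem measurableSet_Ioi).mono fun u hu => hb ε u hε.le hu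
  · refine (MeasureTheory.ae_restrict_mem measurableSet_Ioi).mono fun u hu => ?_
    have hu0 : 0 < u := hU.trans hu
    -- `u > 0` is fixed, so the singular terms `u ^ b / (u + ε) ^ (k + 1)` are continuous at `ε = 0`
    have hf : (b.factorial : ℂ) ≠ 0 := Nat.cast_ne_zero.mpr (Nat.factorial_ne_zero _)
    have hc := continuous_rayPullback him hs
    have h1 : ContinuousAt (fun ε : ℝ => ((b.factorial : ℂ))⁻¹ *
        ((s * u) ^ b * f.rayPullback s (u + ε) * s - ∑ k ∈ Finset.range (b + 1),
          (k.factorial * I1Pred f k) * s ^ (b - k) * (u ^ b / (u + ε) ^ (k + 1) : ℝ))) 0 := by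
      refine continuousAt_const.mul (ContinuousAt.sub ?_ ?_)
      · exact (Continuous.mul (Continuous.mul (by fun_prop) (by fun_prop))
          continuous_const).continuousAt
      · refine tendsto_finsetSum _ fun k _ => Tendsto.const_mul _ ?_
        refine (Complex.continuous_ofReal.tendsto _).comp ?_
        have : ContinuousAt (fun ε : ℝ => u ^ b / (u + ε) ^ (k + 1)) 0 :=
          continuousAt_const.div (by fun_prop) (by rw [add_zero]; positivity)
        exact this.tendsto
    have h2 : ∀ ε : ℝ, 0 ≤ ε → rayIntegrand f b ε s u = ((b.factorial : ℂ))⁻¹ *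
        ((s * u) ^ b * f.rayPullback s (u + ε) * s - ∑ k ∈ Finset.range (b + 1),
          (k.factorial * I1Pred f k) * s ^ (b - k) * (u ^ b / (u + ε) ^ (k + 1) : ℝ)) :=
      fun ε hε => by
        rw [eq_inv_mul_iff_mul_eq₀ hf, rayIntegrand_eq (fun _ => rfl) b hs (by linarith)]
    have h3 := h1.tendsto
    rw [← h2 0 le_rfl] at h3
    refine (h3.mono_left nhdsWithin_le_nhds).congr' ?_
    filter_upwards [self_mem_nhdsWithin] with ε hε
    exact (h2 ε (le_of_lt hε)).symm

/-- On each ray, `log ε` is the only divergence of the regularised integral: below `U` only the term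
`k = b` of `R f b` is not integrable in the limit. -/
theorem tendsto_integral_ray {f : OneForm} (him : ∀ a : ℂ, a.re = 0 → ¬ f.IsPole a)
    {p : ℕ → ℂ} (hp : ∀ n : ℕ, n.factorial * I1Pred f n = p n)
    (b : ℕ) {s : ℂ} (hs : s ^ 2 = -1) {C U : ℝ} (hU : 0 < U)
    (hb : ∀ ε u : ℝ, 0 ≤ ε → U < u → ‖rayIntegrand f b ε s u‖ ≤ C * u ^ (-2 : ℝ)) :
    Tendsto (fun ε : ℝ => b.factorial * (∫ u in Ioi (0 : ℝ), rayIntegrand f b ε s u) -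
      p b * Real.log ε) (𝓝[>] 0) (𝓝 (rayFinitePart f p b s U)) := by
  have hf : (b.factorial : ℂ) ≠ 0 := Nat.cast_ne_zero.mpr (Nat.factorial_ne_zero _)
  have hc := continuous_rayPullback him hs
  have hA : Tendsto (fun ε : ℝ => ∫ u in (0 : ℝ)..U, (s * u) ^ b * f.rayPullback s (u + ε) * s)
      (𝓝[>] 0) (𝓝 (∫ u in (0 : ℝ)..U, (s * u) ^ b * f.rayPullback s u * s)) := by
    have h1 : Continuous fun ε : ℝ =>
        ∫ u in (0 : ℝ)..U, (s * u) ^ b * f.rayPullback s (u + ε) * s := by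
      refine intervalIntegral.continuous_parametric_intervalIntegral_of_continuous' ?_ 0 U
      exact ((by fun_prop : Continuous fun q : ℝ × ℝ => (s * (q.2 : ℂ)) ^ b).mul
        (hc.comp (by fun_prop))).mul continuous_const
    have h2 := h1.tendsto 0
    simp only [add_zero] at h2
    exact h2.mono_left nhdsWithin_le_nhds
  have hB : Tendsto (fun ε : ℝ => ∑ k ∈ Finset.range b, p k * s ^ (b - k) *
      ((∫ u in (0 : ℝ)..U, u ^ b / (u + ε) ^ (k + 1) : ℝ) : ℂ)) (𝓝[>] 0)
      (𝓝 (∑ k ∈ Finset.range b, p k * ((s * U) ^ (b - k) / (b - k : ℕ)))) := by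
    refine tendsto_finsetSum _ fun k hk => ?_
    have h1 := ((Complex.continuous_ofReal.tendsto _).comp
      (tendsto_integral_pow_div (Finset.mem_range.mp hk) hU)).const_mul (p k * s ^ (b - k))
    have h2 : p k * ((s * U) ^ (b - k) / (b - k : ℕ)) =
        p k * s ^ (b - k) * ((U ^ (b - k) / (b - k : ℕ) : ℝ) : ℂ) := by
      push_cast; rw [mul_pow]; ring
    rw [h2]
    exact h1
  have hL : Tendsto (fun ε : ℝ => p b * (((∫ u in (0 : ℝ)..U, u ^ b / (u + ε) ^ (b + 1)) +
      Real.log ε : ℝ) : ℂ)) (𝓝[>] 0) (𝓝 (p b * (Real.log U - (harmonic b : ℂ)))) := by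
    have h1 := ((Complex.continuous_ofReal.tendsto _).comp
      (tendsto_integral_pow_div_log b hU)).const_mul (p b)
    have h2 : ((Real.log U - (harmonic b : ℝ) : ℝ) : ℂ) = Real.log U - (harmonic b : ℂ) := by
      push_cast; rfl
    rw [h2] at h1
    exact h1
  have hT := (tendsto_integral_tail him b hs hU hb).const_mul (b.factorial : ℂ)
  refine (((hA.sub hB).sub hL).add hT).congr' ?_
  filter_upwards [self_mem_nhdsWithin] with ε hε
  have hε : 0 < ε := hε
  have hi := intervalIntegrable_rayIntegrand him b hs hε hU
  have ht := integrableOn_rayIntegrand_tail him b hs hε.le hU fun u => hb ε u hε.le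
  rw [← intervalIntegral.integral_interval_add_Ioi' hi ht, mul_add]
  have hmain : (b.factorial : ℂ) * ∫ u in (0 : ℝ)..U, rayIntegrand f b ε s u =
      (∫ u in (0 : ℝ)..U, (s * u) ^ b * f.rayPullback s (u + ε) * s) -
        ∑ k ∈ Finset.range (b + 1), p k * s ^ (b - k) *
          ((∫ u in (0 : ℝ)..U, u ^ b / (u + ε) ^ (k + 1) : ℝ) : ℂ) := by
    have hci : ∀ k : ℕ, IntervalIntegrable (fun u : ℝ => p k * s ^ (b - k) *
        ((u ^ b / (u + ε) ^ (k + 1) : ℝ) : ℂ)) MeasureTheory.volume 0 U := fun k => by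
      refine ContinuousOn.intervalIntegrable (continuousOn_const.mul
        (Complex.continuous_ofReal.comp_continuousOn (ContinuousOn.div (by fun_prop)
          (by fun_prop) fun u hu => ?_)))
      rw [uIcc_of_le hU.le] at hu
      have : 0 < u + ε := by linarith [hu.1]
      positivity
    have hcA : Continuous fun u : ℝ => (s * u) ^ b * f.rayPullback s (u + ε) * s :=
      ((by fun_prop : Continuous fun u : ℝ => (s * (u : ℂ)) ^ b).mul
        (hc.comp (by fun_prop))).mul continuous_const
    rw [← intervalIntegral.integral_const_mul]
    have h1 : ∫ u in (0 : ℝ)..U, (b.factorial : ℂ) * rayIntegrand f b ε s u =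
        ∫ u in (0 : ℝ)..U, ((s * u) ^ b * f.rayPullback s (u + ε) * s -
          ∑ k ∈ Finset.range (b + 1), p k * s ^ (b - k) *
            ((u ^ b / (u + ε) ^ (k + 1) : ℝ) : ℂ)) := by
      refine intervalIntegral.integral_congr fun u hu => ?_
      rw [uIcc_of_le hU.le] at hu
      exact rayIntegrand_eq hp b hs (by linarith [hu.1])
    rw [h1, intervalIntegral.integral_sub (hcA.intervalIntegrable _ _)
      (by simpa only [Finset.sum_fn] using
        IntervalIntegrable.sum (Finset.range (b + 1)) fun k _ => hci k),
      intervalIntegral.integral_finsetSum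
      fun k _ => hci k]
    congr 1
    refine Finset.sum_congr rfl fun k _ => ?_
    rw [intervalIntegral.integral_const_mul, intervalIntegral.integral_ofReal]
  rw [hmain, Finset.sum_range_succ, Nat.sub_self, pow_zero, mul_one]
  push_cast
  ring

/-- The regularised integrals converge, and `b! 𝓘⁰_b` is given by the finite parts on both rays. -/
theorem tendsto_I0Reg {f : OneForm} (him : ∀ a : ℂ, a.re = 0 → ¬ f.IsPole a)
    {p : ℕ → ℂ} (hp : ∀ n : ℕ, n.factorial * I1Pred f n = p n)
    (b : ℕ) {C U : ℝ} (hU : 0 < U)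
    (hb : ∀ s : ℂ, s ^ 2 = -1 → ∀ ε u : ℝ, 0 ≤ ε → U < u →
      ‖rayIntegrand f b ε s u‖ ≤ C * u ^ (-2 : ℝ)) :
    Tendsto (I0Reg f b) (𝓝[>] 0) (𝓝 ((b.factorial : ℂ)⁻¹ *
      (-rayFinitePart f p b I U - rayFinitePart f p b (-I) U))) := by
  have hf : (b.factorial : ℂ) ≠ 0 := Nat.cast_ne_zero.mpr (Nat.factorial_ne_zero _)
  have hs : I ^ 2 = -1 := Complex.I_sq
  have hs' : (-I) ^ 2 = -1 := by rw [neg_sq, Complex.I_sq]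
  have h1 := tendsto_integral_ray him hp b hs hU (hb _ hs)
  have h2 := tendsto_integral_ray him hp b hs' hU (hb _ hs')
  refine ((h1.neg.sub h2).const_mul (b.factorial : ℂ)⁻¹).congr fun ε => ?_
  rw [I0Reg, inv_mul_eq_iff_eq_mul₀ hf, ← hp]
  ring

theorem norm_integral_tail_le {f : OneForm} {b : ℕ} {s : ℂ} {C U : ℝ} (hU : 0 < U)
    (hb : ∀ u : ℝ, U < u → ‖rayIntegrand f b 0 s u‖ ≤ C * u ^ (-2 : ℝ)) :
    ‖∫ u in Ioi U, rayIntegrand f b 0 s u‖ ≤ C / U := by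
  have h1 : ∫ u in Ioi U, C * u ^ (-2 : ℝ) = C / U := by
    rw [MeasureTheory.integral_const_mul, integral_Ioi_rpow_of_lt (by norm_num) hU,
      show (-2 : ℝ) + 1 = -1 by norm_num, Real.rpow_neg_one]
    ring
  rw [← h1]
  exact MeasureTheory.norm_integral_le_of_norm_le
    ((integrableOn_Ioi_rpow_of_lt (by norm_num) hU).const_mul C)
    ((MeasureTheory.ae_restrict_mem measurableSet_Ioi).mono fun u hu => hb u hu)

/-! ### Residues, and Cauchy's theorem on a rectangle -/

theorem exists_laurent_aux {a : ℂ} (n : ℕ) : ∀ {g H : ℂ → ℂ}, AnalyticAt ℂ H a →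
    (∀ᶠ z in 𝓝[≠] a, (z - a) ^ n * g z = H z) →
    ∃ (d : ℕ → ℂ) (h : ℂ → ℂ), AnalyticAt ℂ h a ∧
      g =ᶠ[𝓝[≠] a] fun z => (∑ k ∈ Finset.range n, d k * ((z - a) ^ (k + 1))⁻¹) + h z := by
  induction n with
  | zero =>
    intro g H hH hg
    exact ⟨0, H, hH, by filter_upwards [hg] with z hz; simpa using hz⟩
  | succ n ih =>
    intro g H hH hg
    have hH1 : AnalyticAt ℂ (dslope H a) a := by
      obtain ⟨p, hp⟩ := hH
      exact hp.has_fpower_series_dslope_fslope.analyticAt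
    obtain ⟨d, h, hh, hd⟩ := ih (g := fun z => g z - H a * ((z - a) ^ (n + 1))⁻¹) hH1 (by
      filter_upwards [hg, self_mem_nhdsWithin] with z hz hza
      have hza : z - a ≠ 0 := sub_ne_zero.mpr hza
      rw [dslope_of_ne _ (sub_ne_zero.mp hza), slope_def_field, ← hz, pow_succ]
      field_simp)
    refine ⟨fun k => if k = n then H a else d k, h, hh, ?_⟩
    filter_upwards [hd] with z hz
    rw [Finset.sum_range_succ, if_pos rfl, Finset.sum_congr rfl fun k hk => by
      rw [if_neg (Finset.mem_range.mp hk).ne], add_right_comm, ← hz]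
    ring

/-- The principal part of a meromorphic function, with room for at least a simple pole. -/
theorem _root_.MeromorphicAt.exists_laurent {a : ℂ} {g : ℂ → ℂ} (hg : MeromorphicAt g a) :
    ∃ (n : ℕ) (d : ℕ → ℂ) (h : ℂ → ℂ), AnalyticAt ℂ h a ∧ g =ᶠ[𝓝[≠] a]
      fun z => (∑ k ∈ Finset.range (n + 1), d k * ((z - a) ^ (k + 1))⁻¹) + h z := by
  obtain ⟨n, hn⟩ := hg
  refine ⟨n, exists_laurent_aux (n + 1) (H := fun z => (z - a) * ((z - a) ^ n • g z))
    ((analyticAt_id.sub analyticAt_const).mul hn) (Eventually.of_forall fun z => ?_)⟩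
  rw [smul_eq_mul, pow_succ]; ring

theorem circleIntegral_inv_pow_of_mem_ball {c a : ℂ} {R : ℝ} (ha : a ∈ Metric.ball c R) (k : ℕ) :
    ∮ z in C(c, R), ((z - a) ^ (k + 1))⁻¹ = if k = 0 then 2 * Real.pi * I else 0 := by
  split_ifs with h
  · simp only [h, zero_add, pow_one]
    exact circleIntegral.integral_sub_inv_of_mem_ball ha
  · have h1 := circleIntegral.integral_sub_zpow_of_ne (n := -((k + 1 : ℕ) : ℤ))
      (by push_cast; omega) c a R
    simpa only [zpow_neg, zpow_natCast] using h1

theorem circleIntegral_inv_pow_of_lt {c a : ℂ} {R : ℝ} (hR : 0 ≤ R) (ha : R < ‖a - c‖) (k : ℕ) :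
    ∮ z in C(c, R), ((z - a) ^ (k + 1))⁻¹ = 0 := by
  have hne : ∀ z ∈ Metric.closedBall c R, (z - a) ^ (k + 1) ≠ 0 := fun z hz => by
    refine pow_ne_zero _ (sub_ne_zero.mpr ?_)
    rintro rfl
    rw [Metric.mem_closedBall, dist_eq_norm] at hz
    linarith
  refine Complex.circleIntegral_eq_zero_of_differentiable_on_off_countable hR countable_empty
    (ContinuousOn.inv₀ (by fun_prop) hne) fun z hz => ?_
  have := hne z (Metric.ball_subset_closedBall hz.1)
  fun_prop (disch := assumption)

theorem circleIntegrable_inv_pow {c a : ℂ} {R : ℝ} (hR : 0 ≤ R) (ha : ‖a - c‖ ≠ R) (k : ℕ)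
    (d : ℂ) :
    CircleIntegrable (fun z => d * ((z - a) ^ (k + 1))⁻¹) c R := by
  refine ContinuousOn.circleIntegrable hR (continuousOn_const.mul
    (ContinuousOn.inv₀ (by fun_prop) fun z hz => pow_ne_zero _ (sub_ne_zero.mpr ?_)))
  rintro rfl
  exact ha (by simpa [dist_eq_norm] using hz)

theorem residue_eq_of_laurent {g h : ℂ → ℂ} {a : ℂ} {n : ℕ} {d : ℕ → ℂ} (hh : AnalyticAt ℂ h a)
    (hg : g =ᶠ[𝓝[≠] a]
      fun z => (∑ k ∈ Finset.range (n + 1), d k * ((z - a) ^ (k + 1))⁻¹) + h z) :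
    residue g a = d 0 := by
  refine Tendsto.limUnder_eq (tendsto_const_nhds.congr' ?_)
  obtain ⟨ε, hε, hb⟩ := Metric.eventually_nhds_iff_ball.mp
    ((eventually_nhdsWithin_iff.mp hg).and hh.eventually_analyticAt)
  filter_upwards [Ioo_mem_nhdsGT hε] with r hr
  have hr0 := hr.1
  have hsub : Metric.closedBall a r ⊆ Metric.ball a ε := Metric.closedBall_subset_ball hr.2
  have h1 : ∮ z in C(a, r), g z =
      ∮ z in C(a, r), ((∑ k ∈ Finset.range (n + 1), d k * ((z - a) ^ (k + 1))⁻¹) + h z) := by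
    refine circleIntegral.integral_congr hr0.le fun z hz => ?_
    refine (hb z (hsub (Metric.sphere_subset_closedBall hz))).1 ?_
    rintro rfl
    simp at hz
    linarith
  have hhc : ContinuousOn h (Metric.closedBall a r) := fun z hz =>
    (hb z (hsub hz)).2.continuousAt.continuousWithinAt
  have h2 : ∮ z in C(a, r), h z = 0 :=
    Complex.circleIntegral_eq_zero_of_differentiable_on_off_countable hr0.le countable_empty hhc
      fun z hz => (hb z (hsub (Metric.ball_subset_closedBall hz.1))).2.differentiableAt
  have hI : ∀ k, CircleIntegrable (fun z => d k * ((z - a) ^ (k + 1))⁻¹) a r := fun k =>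
    circleIntegrable_inv_pow hr0.le (by simpa using hr0.ne) k _
  rw [h1, circleIntegral.integral_add
    (by simpa only [Finset.sum_fn] using
      CircleIntegrable.sum (Finset.range (n + 1)) fun k _ => hI k)
    ((hhc.mono Metric.sphere_subset_closedBall).circleIntegrable hr0.le), h2, add_zero,
    circleIntegral.integral_fun_sum fun k _ => hI k]
  simp only [circleIntegral.integral_const_mul,
    circleIntegral_inv_pow_of_mem_ball (Metric.mem_ball_self hr0), mul_ite, mul_zero]
  rw [Finset.sum_ite_eq' (Finset.range (n + 1)) 0, if_pos (by simp)]
  have := Complex.two_pi_I_ne_zero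
  field_simp

theorem residue_eq_zero_of_analyticAt {g : ℂ → ℂ} {a : ℂ} (hg : AnalyticAt ℂ g a) :
    residue g a = 0 :=
  residue_eq_of_laurent (n := 0) (d := 0) hg (Eventually.of_forall fun z => by simp)

/-- The integral of `g` over the boundary of the rectangle `[-T, T] × [a, a + 2π]`. -/
noncomputable def rectInt (a T : ℝ) (g : ℂ → ℂ) : ℂ :=
  (∫ t in (-T)..T, g (t + a * I)) - (∫ t in (-T)..T, g (t + (a + 2 * Real.pi : ℝ) * I)) +
    arc a T g - arc a (-T) g

/-- Taking punctured limits removes the removable singularities near `w`. -/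
theorem limUnder_eventuallyEq {g h : ℂ → ℂ} {w : ℂ} (hh : AnalyticAt ℂ h w)
    (hg : g =ᶠ[𝓝[≠] w] h) : (fun v => limUnder (𝓝[≠] v) g) =ᶠ[𝓝 w] h := by
  have h1 : ∀ᶠ v in 𝓝[≠] w, ∀ᶠ v' in 𝓝[≠] v, g v' = h v' := by
    filter_upwards [eventually_eventually_nhdsWithin.mpr hg, self_mem_nhdsWithin] with v hv hvw
    rw [IsOpen.nhdsWithin_eq isOpen_compl_singleton hvw] at hv
    exact nhdsWithin_le_nhds hv
  have h2 : ∀ᶠ v in 𝓝 w, ∀ᶠ v' in 𝓝[≠] v, g v' = h v' := by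
    rw [← nhdsNE_sup_pure]
    exact ⟨h1, hg⟩
  filter_upwards [h2, hh.eventually_analyticAt] with v hv hv'
  exact Tendsto.limUnder_eq
    ((hv'.continuousAt.tendsto.mono_left nhdsWithin_le_nhds).congr' (EventuallyEq.symm hv))

theorem rectInt_congr {a T : ℝ} {g h : ℂ → ℂ} (hT : 0 < T)
    (hb : ∀ w : ℂ, |w.re| ≤ T → w.im = a ∨ w.im = a + 2 * Real.pi → g w = h w)
    (hv : ∀ w : ℂ, |w.re| = T → w.im ∈ Icc a (a + 2 * Real.pi) → g w = h w) :
    rectInt a T g = rectInt a T h := by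
  have hp := Real.pi_pos
  have hI : ∀ t ∈ uIcc (-T) T, ∀ θ : ℝ, |((t : ℂ) + θ * I).re| ≤ T := fun t ht θ => by
    rw [uIcc_of_le (by linarith)] at ht
    rw [re_add_mul_I]; exact abs_le.mpr ht
  unfold rectInt arc
  congr 1
  · congr 1
    · congr 1
      · exact intervalIntegral.integral_congr fun t ht =>
          hb _ (hI t ht a) (Or.inl (im_add_mul_I _ _))
      · exact intervalIntegral.integral_congr fun t ht =>
          hb _ (hI t ht _) (Or.inr (im_add_mul_I _ _))
    · congr 1
      refine intervalIntegral.integral_congr fun θ hθ => hv _ ?_ ?_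
      · rw [re_add_mul_I, abs_of_pos hT]
      · rw [uIcc_of_le (by linarith)] at hθ
        rwa [im_add_mul_I]
  · congr 1
    refine intervalIntegral.integral_congr fun θ hθ => hv _ ?_ ?_
    · rw [re_add_mul_I, abs_neg, abs_of_pos hT]
    · rw [uIcc_of_le (by linarith)] at hθ
      rwa [im_add_mul_I]

/-- Cauchy's theorem on a rectangle for a function with removable singularities. -/
theorem rectInt_eq_zero {a T : ℝ} {g : ℂ → ℂ} (hT : 0 < T)
    (h : ∀ w : ℂ, |w.re| ≤ T → w.im ∈ Icc a (a + 2 * Real.pi) →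
      ∃ φ : ℂ → ℂ, AnalyticAt ℂ φ w ∧ g =ᶠ[𝓝[≠] w] φ)
    (hb : ∀ w : ℂ, |w.re| ≤ T → w.im = a ∨ w.im = a + 2 * Real.pi → ContinuousAt g w)
    (hv : ∀ w : ℂ, |w.re| = T → w.im ∈ Icc a (a + 2 * Real.pi) → ContinuousAt g w) :
    rectInt a T g = 0 := by
  have hp := Real.pi_pos
  have hlim : ∀ w : ℂ, ContinuousAt g w → g w = limUnder (𝓝[≠] w) g := fun w hw =>
    (Tendsto.limUnder_eq (hw.tendsto.mono_left nhdsWithin_le_nhds)).symm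
  rw [rectInt_congr hT (h := fun v => limUnder (𝓝[≠] v) g)
    (fun w h1 h2 => hlim w (hb w h1 h2)) (fun w h1 h2 => hlim w (hv w h1 h2))]
  have h0 := Complex.integral_boundary_rect_eq_zero_of_differentiableOn
    (fun v => limUnder (𝓝[≠] v) g) (⟨-T, a⟩ : ℂ) ⟨T, a + 2 * Real.pi⟩ (by
      intro w hw
      rw [Complex.mem_reProdIm, uIcc_of_le (by simp; linarith),
        uIcc_of_le (by simp; linarith)] at hw
      obtain ⟨φ, hφ, hgφ⟩ := h w (abs_le.mpr hw.1) hw.2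
      exact (hφ.congr (limUnder_eventuallyEq hφ hgφ).symm).differentiableAt.differentiableWithinAt)
  simpa [rectInt, arc] using h0

theorem rectInt_sub {a T : ℝ} {g h : ℂ → ℂ} (hT : 0 < T)
    (hgb : ∀ w : ℂ, |w.re| ≤ T → w.im = a ∨ w.im = a + 2 * Real.pi → ContinuousAt g w)
    (hgv : ∀ w : ℂ, |w.re| = T → ContinuousAt g w)
    (hhb : ∀ w : ℂ, |w.re| ≤ T → w.im = a ∨ w.im = a + 2 * Real.pi → ContinuousAt h w)
    (hhv : ∀ w : ℂ, |w.re| = T → ContinuousAt h w) :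
    rectInt a T (fun w => g w - h w) = rectInt a T g - rectInt a T h := by
  have hor : ∀ {g : ℂ → ℂ}, (∀ w : ℂ, |w.re| ≤ T → w.im = a ∨ w.im = a + 2 * Real.pi →
      ContinuousAt g w) → ∀ θ : ℝ, (θ = a ∨ θ = a + 2 * Real.pi) →
      IntervalIntegrable (fun t : ℝ => g (t + θ * I)) MeasureTheory.volume (-T) T := by
    intro g hg θ hθ
    refine ContinuousOn.intervalIntegrable fun t ht => ContinuousAt.continuousWithinAt ?_
    rw [uIcc_of_le (by linarith)] at ht
    refine ContinuousAt.comp (f := fun t : ℝ => (t : ℂ) + θ * I)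
      (hg _ ?_ ?_) (by fun_prop)
    · rw [re_add_mul_I]; exact abs_le.mpr ht
    · rwa [im_add_mul_I]
  have ver : ∀ {g : ℂ → ℂ}, (∀ w : ℂ, |w.re| = T → ContinuousAt g w) → ∀ t : ℝ, |t| = T →
      Continuous (fun θ : ℝ => g (t + θ * I)) := by
    intro g hg t ht
    refine continuous_iff_continuousAt.mpr fun θ => ?_
    exact ContinuousAt.comp (f := fun θ : ℝ => (t : ℂ) + θ * I)
      (hg _ (by rwa [re_add_mul_I])) (by fun_prop)
  have hT1 : |T| = T := abs_of_pos hT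
  have hT2 : |-T| = T := by rw [abs_neg, hT1]
  have hn : ((-T : ℝ) : ℂ) = -(T : ℂ) := by push_cast; rfl
  unfold rectInt
  rw [intervalIntegral.integral_sub (hor hgb _ (Or.inl rfl)) (hor hhb _ (Or.inl rfl)),
    intervalIntegral.integral_sub (hor hgb _ (Or.inr rfl)) (hor hhb _ (Or.inr rfl)),
    arc_sub (ver hgv T hT1) (ver hhv T hT1), arc_sub (ver hgv (-T) hT2) (ver hhv (-T) hT2)]
  ring

theorem exp_add_period (w : ℂ) (k : ℝ) :
    exp (w + ((k + 2 * Real.pi : ℝ) : ℂ) * I) = exp (w + k * I) := by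
  have : w + ((k + 2 * Real.pi : ℝ) : ℂ) * I = w + k * I + 2 * Real.pi * I := by push_cast; ring
  rw [this, Complex.exp_periodic]

/-- By periodicity the starting angle of the circle is immaterial. -/
theorem arc_exp (a t : ℝ) (g : ℂ → ℂ) :
    arc a t (fun w => g (exp w) * exp w) = ∮ z in C(0, Real.exp t), g z := by
  have h1 : Function.Periodic (fun θ : ℝ => g (exp (t + θ * I)) * exp (t + θ * I))
      (2 * Real.pi) := fun θ => by
    simp only [exp_add_period]
  have h2 := h1.intervalIntegral_add_eq a 0
  rw [zero_add] at h2
  rw [arc, h2, circleIntegral, ← intervalIntegral.integral_const_mul]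
  refine intervalIntegral.integral_congr fun θ _ => ?_
  have h3 : circleMap 0 (Real.exp t) θ = exp (t + θ * I) := by
    rw [circleMap, zero_add, Complex.ofReal_exp, ← Complex.exp_add]
  simp only [deriv_circleMap, smul_eq_mul, h3]
  ring

theorem rectInt_exp (a T : ℝ) (g : ℂ → ℂ) :
    rectInt a T (fun w => g (exp w) * exp w) =
      (∮ z in C(0, Real.exp T), g z) - ∮ z in C(0, Real.exp (-T)), g z := by
  rw [rectInt, arc_exp, arc_exp]
  simp only [exp_add_period]
  ring

/-! ### The residue theorem on the slit annulus -/

theorem im_mem_Ioo_of_re_exp_ne_zero {w : ℂ}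
    (h1 : w.im ∈ Icc (-(Real.pi / 2)) (-(Real.pi / 2) + 2 * Real.pi))
    (h2 : (exp w).re ≠ 0) :
    w.im ∈ Ioo (-(Real.pi / 2)) (3 * Real.pi / 2) := by
  have h3 : -(Real.pi / 2) + 2 * Real.pi = 3 * Real.pi / 2 := by ring
  rw [h3] at h1
  rw [Complex.exp_re] at h2
  refine ⟨lt_of_le_of_ne h1.1 ?_, lt_of_le_of_ne h1.2 ?_⟩ <;> intro h <;> apply h2
  · rw [← h, Real.cos_neg, Real.cos_pi_div_two, mul_zero]
  · rw [h, ← h3, Real.cos_add_two_pi, Real.cos_neg, Real.cos_pi_div_two, mul_zero]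

theorem re_exp_eq_zero {w : ℂ} (h : w.im = -(Real.pi / 2) ∨ w.im = -(Real.pi / 2) + 2 * Real.pi) :
    (exp w).re = 0 := by
  rw [Complex.exp_re]
  rcases h with h | h <;> rw [h]
  · rw [Real.cos_neg, Real.cos_pi_div_two, mul_zero]
  · rw [Real.cos_add_two_pi, Real.cos_neg, Real.cos_pi_div_two, mul_zero]

/-- The residue theorem in the plane slit along `-i ℝ`, for the annulus `e^(-T) ≤ |z| ≤ e^T`.
In the coordinate `w = log z` the slit annulus is a rectangle and `ln z` is `w`. -/
theorem rectInt_eq_sum_residue {f : OneForm} (him : ∀ a : ℂ, a.re = 0 → ¬ f.IsPole a) {T : ℝ}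
    (hT : 0 < T) (hpole : ∀ a, f.IsPole a → Real.exp (-T) < ‖a‖ ∧ ‖a‖ < Real.exp T)
    {P : ℂ → ℂ} (hP : ∀ w : ℂ, |w.re| ≤ T → AnalyticAt ℂ P (exp w)) :
    rectInt (-(Real.pi / 2)) T (fun w => f.coeff (exp w) * exp w * P (exp w) * w) =
      2 * Real.pi * I * ∑ a ∈ f.finite_poles.toFinset,
        residue (fun z => f.coeff z * ln z * P z) a := by
  classical
  set S := f.finite_poles.toFinset with hS
  have hmem : ∀ a, a ∈ S ↔ f.IsPole a := fun a => by rw [hS, Set.Finite.mem_toFinset]; rfl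
  have hPa : ∀ a, f.IsPole a → AnalyticAt ℂ P a := fun a ha => by
    obtain ⟨h1, h2⟩ := hpole a ha
    have ha0 : a ≠ 0 := by rintro rfl; rw [norm_zero] at h1; exact absurd h1 (Real.exp_pos _).not_gt
    rw [← Complex.exp_log ha0]
    refine hP _ ?_
    rw [Complex.log_re, abs_le]
    have hn := norm_pos_iff.mpr ha0
    exact ⟨by rw [Real.le_log_iff_exp_le hn]; exact h1.le,
      by rw [Real.log_le_iff_le_exp hn]; exact h2.le⟩
  have hdec : ∀ a, f.IsPole a → ∃ (n : ℕ) (d : ℕ → ℂ) (h : ℂ → ℂ), AnalyticAt ℂ h a ∧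
      (fun z => f.coeff z * ln z * P z) =ᶠ[𝓝[≠] a]
      fun z => (∑ k ∈ Finset.range (n + 1), d k * ((z - a) ^ (k + 1))⁻¹) + h z := fun a ha => by
    have hre : a.re ≠ 0 := fun h => him a h ha
    exact (((f.meromorphicNFAt a).meromorphicAt.mul (analyticAt_ln hre).meromorphicAt).mul
      (hPa a ha).meromorphicAt).exists_laurent
  choose! N d h hh hd using hdec
  -- `τ` is the sum of all principal parts: subtracting it removes the poles in the rectangle, and
  -- its own contour integral reduces to circles in the `z`-plane
  let τ₁ : ℂ → ℂ → ℂ := fun a z => ∑ k ∈ Finset.range (N a + 1), d a k * ((z - a) ^ (k + 1))⁻¹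
  let τ : ℂ → ℂ := fun z => ∑ a ∈ S, τ₁ a z
  have hτ₁ : ∀ a z, z ≠ a → AnalyticAt ℂ (τ₁ a) z := fun a z hz => by
    have h0 : z - a ≠ 0 := sub_ne_zero.mpr hz
    refine Finset.analyticAt_fun_sum _ fun k _ => analyticAt_const.mul (AnalyticAt.inv ?_ ?_)
    · exact (analyticAt_id.sub analyticAt_const).pow _
    · exact pow_ne_zero _ h0
  have hτ : ∀ z, z ∉ S → AnalyticAt ℂ τ z := fun z hz =>
    Finset.analyticAt_fun_sum _ fun a ha => hτ₁ a z fun h => hz (h ▸ ha)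
  -- away from the poles both functions are analytic
  have hG : ∀ w : ℂ, |w.re| ≤ T → exp w ∉ S →
      AnalyticAt ℂ (fun w => f.coeff (exp w) * exp w * P (exp w) * w) w := fun w hw hwS => by
    have h1 : AnalyticAt ℂ f.coeff (exp w) := analyticAt_coeff fun h => hwS ((hmem _).mpr h)
    have he : AnalyticAt ℂ exp w := by fun_prop
    exact (((h1.comp he).mul he).mul ((hP w hw).comp he)).mul analyticAt_id
  have hτe : ∀ w : ℂ, exp w ∉ S → AnalyticAt ℂ (fun w => τ (exp w) * exp w) w := fun w hwS => by
    have he : AnalyticAt ℂ exp w := by fun_prop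
    exact ((hτ _ hwS).comp he).mul he
  have hb : ∀ w : ℂ, w.im = -(Real.pi / 2) ∨ w.im = -(Real.pi / 2) + 2 * Real.pi →
      exp w ∉ S := fun w hw hwS => him _ (re_exp_eq_zero hw) ((hmem _).mp hwS)
  have hv : ∀ w : ℂ, |w.re| = T → exp w ∉ S := fun w hw hwS => by
    obtain ⟨h1, h2⟩ := hpole _ ((hmem _).mp hwS)
    rw [Complex.norm_exp, Real.exp_lt_exp] at h1 h2
    exact absurd hw (abs_lt.mpr ⟨h1, h2⟩).ne
  have key : rectInt (-(Real.pi / 2)) T (fun w => f.coeff (exp w) * exp w * P (exp w) * w -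
      τ (exp w) * exp w) = 0 := by
    refine rectInt_eq_zero hT ?_ ?_ ?_
    · intro w hw hwi
      by_cases hwS : exp w ∈ S
      · set a := exp w with ha
        have hpa := (hmem a).mp hwS
        have hre : (exp w).re ≠ 0 := fun h => him _ h hpa
        have hio := im_mem_Ioo_of_re_exp_ne_zero hwi hre
        have he : AnalyticAt ℂ exp w := by fun_prop
        have hrest : AnalyticAt ℂ (fun z => ∑ b ∈ S.erase a, τ₁ b z) a :=
          Finset.analyticAt_fun_sum _ fun b hb => hτ₁ b a (Finset.ne_of_mem_erase hb).symm
        refine ⟨fun v => (h a (exp v) - ∑ b ∈ S.erase a, τ₁ b (exp v)) * exp v,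
          (((hh a hpa).comp_of_eq he ha.symm).sub (hrest.comp_of_eq he ha.symm)).mul he, ?_⟩
        have ht : Tendsto exp (𝓝[≠] w) (𝓝[≠] a) :=
          (Complex.hasDerivAt_exp w).tendsto_nhdsNE (Complex.exp_ne_zero w)
        have hstrip : ∀ᶠ v : ℂ in 𝓝[≠] w, v.im ∈ Ioo (-(Real.pi / 2)) (3 * Real.pi / 2) :=
          nhdsWithin_le_nhds
            (Complex.continuous_im.continuousAt.eventually (Ioo_mem_nhds hio.1 hio.2))
        filter_upwards [ht.eventually (hd a hpa), hstrip] with v hv1 hv2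
        rw [ln_exp hv2.1 hv2.2.le] at hv1
        have hsum : τ (exp v) = τ₁ a (exp v) + ∑ b ∈ S.erase a, τ₁ b (exp v) :=
          (Finset.add_sum_erase S (fun b => τ₁ b (exp v)) hwS).symm
        rw [hsum]
        have hτa : τ₁ a (exp v) =
          ∑ k ∈ Finset.range (N a + 1), d a k * ((exp v - a) ^ (k + 1))⁻¹ := rfl
        rw [← hτa] at hv1
        linear_combination exp v * hv1
      · exact ⟨_, (hG w hw hwS).sub (hτe w hwS), EventuallyEq.rfl⟩
    · exact fun w hw h1 => ((hG w hw (hb w h1)).sub (hτe w (hb w h1))).continuousAt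
    · exact fun w hw _ => ((hG w hw.le (hv w hw)).sub (hτe w (hv w hw))).continuousAt
  rw [rectInt_sub hT (fun w hw h1 => (hG w hw (hb w h1)).continuousAt)
    (fun w hw => (hG w hw.le (hv w hw)).continuousAt)
    (fun w _ h1 => (hτe w (hb w h1)).continuousAt) (fun w hw => (hτe w (hv w hw)).continuousAt),
    sub_eq_zero, rectInt_exp] at key
  have hI : ∀ a ∈ S, ∀ R : ℝ, 0 ≤ R → ‖a‖ ≠ R →
      ∀ k, CircleIntegrable (fun z => d a k * ((z - a) ^ (k + 1))⁻¹) 0 R := fun a _ R hR haR k =>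
    circleIntegrable_inv_pow hR (by rwa [sub_zero]) k _
  have hI' : ∀ a ∈ S, ∀ R : ℝ, 0 ≤ R → ‖a‖ ≠ R → CircleIntegrable (τ₁ a) 0 R :=
    fun a ha R hR haR => by
      simpa only [Finset.sum_fn] using
        CircleIntegrable.sum (Finset.range (N a + 1)) fun k _ => hI a ha R hR haR k
  have houter : ∮ z in C(0, Real.exp T), τ z = 2 * Real.pi * I * ∑ a ∈ S, d a 0 := by
    rw [circleIntegral.integral_fun_sum fun a ha => hI' a ha _ (Real.exp_pos T).le
      (hpole a ((hmem a).mp ha)).2.ne, Finset.mul_sum]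
    refine Finset.sum_congr rfl fun a ha => ?_
    have hlt := (hpole a ((hmem a).mp ha)).2
    rw [circleIntegral.integral_fun_sum fun k _ => hI a ha _ (Real.exp_pos T).le hlt.ne k]
    simp only [circleIntegral.integral_const_mul,
      circleIntegral_inv_pow_of_mem_ball (mem_ball_zero_iff.mpr hlt), mul_ite, mul_zero]
    rw [Finset.sum_ite_eq' (Finset.range (N a + 1)) 0, if_pos (by simp)]
    ring
  have hinner : ∮ z in C(0, Real.exp (-T)), τ z = 0 := by
    rw [circleIntegral.integral_fun_sum fun a ha => hI' a ha _ (Real.exp_pos _).le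
      (hpole a ((hmem a).mp ha)).1.ne']
    refine Finset.sum_eq_zero fun a ha => ?_
    have hlt := (hpole a ((hmem a).mp ha)).1
    rw [circleIntegral.integral_fun_sum fun k _ => hI a ha _ (Real.exp_pos _).le hlt.ne' k]
    refine Finset.sum_eq_zero fun k _ => ?_
    rw [circleIntegral.integral_const_mul, circleIntegral_inv_pow_of_lt (Real.exp_pos _).le
      (by rwa [sub_zero]), mul_zero]
  rw [key, houter, hinner, sub_zero]
  congr 1
  exact Finset.sum_congr rfl fun a ha =>
    (residue_eq_of_laurent (hh a ((hmem a).mp ha)) (hd a ((hmem a).mp ha))).symm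

/-! ### Symmetry of the contour -/

/-- In the coordinate `w = log z`, the symmetry of `f` says that its coefficient is even. -/
theorem OneForm.IsOdd.coeff_exp_neg {f : OneForm} (hodd : f.IsOdd) (w : ℂ) :
    f.coeff (exp (-w)) * exp (-w) = f.coeff (exp w) * exp w := by
  have h0 := Complex.exp_ne_zero w
  have h := hodd _ h0
  rw [Complex.exp_neg]
  field_simp at h ⊢
  linear_combination -h

/-- The circles of radii `e^t` and `e^(-t)` are exchanged by `z ↦ 1/z`, which also reflects the
position of the cut. -/
theorem arc_neg {a t : ℝ} {K : ℂ → ℂ} (heven : ∀ w, K (-w) = K w) :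
    arc a (-t) (fun w => K w * w) = -arc (-a - 2 * Real.pi) t (fun w => K w * w) := by
  have h1 := intervalIntegral.integral_comp_neg (a := a) (b := a + 2 * Real.pi)
    (fun θ : ℝ => K (t + θ * I) * (t + θ * I))
  have h2 : -(a + 2 * Real.pi) = -a - 2 * Real.pi := by ring
  have h3 : -a - 2 * Real.pi + 2 * Real.pi = -a := by ring
  rw [arc, arc, h3, ← h2, ← h1, ← mul_neg, ← intervalIntegral.integral_neg]
  congr 1
  refine intervalIntegral.integral_congr fun θ _ => ?_
  have h4 : ((-t : ℝ) : ℂ) + θ * I = -(t + (-θ : ℝ) * I) := by push_cast; ring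
  simp only [h4, heven]
  ring

/-- Across the cut the logarithm jumps by `2πi`; the symmetry moves the inner circle to the outer
one. -/
theorem rectInt_mul_self {a T : ℝ} {K : ℂ → ℂ} (heven : ∀ w, K (-w) = K w)
    (hper : ∀ (w : ℂ) (k : ℝ), K (w + ((k + 2 * Real.pi : ℝ) : ℂ) * I) = K (w + k * I))
    (hc : Continuous fun t : ℝ => K (t + a * I)) :
    rectInt a T (fun w => K w * w) = -(2 * Real.pi * I) * (∫ t in (-T)..T, K (t + a * I)) +
      arc a T (fun w => K w * w) + arc (-a - 2 * Real.pi) T (fun w => K w * w) := by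
  rw [rectInt, arc_neg heven, sub_neg_eq_add]
  congr 2
  simp only [hper]
  have hi : ∀ c : ℝ, IntervalIntegrable (fun t : ℝ => K (t + a * I) * (t + c * I))
      MeasureTheory.volume (-T) T := fun c => (hc.mul (by fun_prop)).intervalIntegrable _ _
  rw [← intervalIntegral.integral_sub (hi _) (hi _), ← intervalIntegral.integral_const_mul]
  refine intervalIntegral.integral_congr fun t _ => ?_
  push_cast
  ring

theorem rayPoint_two_sinh (s : ℂ) (t : ℝ) : rayPoint s (2 * Real.sinh t) = s * exp t := by
  have h1 : √((2 * Real.sinh t) ^ 2 + 4) = 2 * Real.cosh t := by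
    rw [Real.sqrt_eq_iff_mul_self_eq (by positivity) (by have := Real.cosh_pos t; positivity)]
    have := Real.cosh_sq t
    nlinarith
  have h2 : (2 * Real.sinh t + 2 * Real.cosh t) / 2 = Real.exp t := by
    rw [← Real.sinh_add_cosh]; ring
  rw [rayPoint, h1, h2, Complex.ofReal_exp]

theorem rayPullback_two_sinh (f : OneForm) {s : ℂ} (hs : s ^ 2 = -1) (t : ℝ) :
    f.rayPullback s (2 * Real.sinh t) * s * (2 * Real.cosh t : ℝ) =
      f.coeff (s * exp t) * (s * exp t) := by
  have hs0 : s ≠ 0 := by rintro rfl; norm_num at hs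
  have hd : dx (s * exp t) ≠ 0 := by
    rw [← Complex.ofReal_exp]
    exact dx_mul_ofReal_ne_zero hs (Real.exp_pos t)
  have h1 : s * (2 * Real.cosh t : ℝ) = dx (s * exp t) * (s * exp t) := by
    have h0 := Complex.exp_ne_zero t
    rw [dx, mul_pow, hs]
    push_cast
    rw [Complex.cosh, Complex.exp_neg]
    field_simp
    ring
  rw [OneForm.rayPullback, rayPoint_two_sinh, mul_assoc, h1]
  field_simp

theorem two_cosh_of_exp {T σ : ℝ} {s : ℂ} (hs : s ^ 2 = -1) (hσ : exp (σ * I) = s) :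
    2 * Complex.cosh (T + σ * I) = s * (2 * Real.sinh T : ℝ) := by
  have hs0 : s ≠ 0 := by rintro rfl; norm_num at hs
  have h0 := Complex.exp_ne_zero T
  have h1 : exp (T + σ * I) = s * exp T := by rw [Complex.exp_add, hσ, mul_comm]
  rw [← x_exp, h1, x]
  push_cast
  rw [Complex.sinh, Complex.exp_neg]
  field_simp
  linear_combination hs

/-- The substitution `u = 2 sinh t`, that is `z = s e^t`, `x = s u`. -/
theorem integral_ray {f : OneForm} (him : ∀ a : ℂ, a.re = 0 → ¬ f.IsPole a) {s : ℂ}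
    (hs : s ^ 2 = -1) {σ : ℝ} (hσ : exp (σ * I) = s) (n : ℕ) (T : ℝ) :
    ∫ t in (0 : ℝ)..T, f.coeff (exp (t + σ * I)) * exp (t + σ * I) *
        (2 * Complex.cosh (t + σ * I)) ^ n =
      ∫ u in (0 : ℝ)..(2 * Real.sinh T), (s * u) ^ n * f.rayPullback s u * s := by
  have hc := continuous_rayPullback him hs
  have hs0 : s ≠ 0 := by rintro rfl; norm_num at hs
  have hsub := intervalIntegral.integral_deriv_smul_comp (a := 0) (b := T)
    (f := fun t : ℝ => 2 * Real.sinh t) (f' := fun t => 2 * Real.cosh t)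
    (g := fun u : ℝ => (s * u) ^ n * f.rayPullback s u * s)
    (fun t _ => (Real.hasDerivAt_sinh t).const_mul 2) (by fun_prop)
    (((by fun_prop : Continuous fun u : ℝ => (s * (u : ℂ)) ^ n).mul hc).mul continuous_const)
  simp only [Real.sinh_zero, mul_zero] at hsub
  rw [← hsub]
  refine intervalIntegral.integral_congr fun t _ => ?_
  have h1 : exp (t + σ * I) = s * exp t := by rw [Complex.exp_add, hσ, mul_comm]
  have h2 : 2 * Complex.cosh (t + σ * I) = s * (2 * Real.sinh t : ℝ) := two_cosh_of_exp hs hσ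
  have h3 := rayPullback_two_sinh f hs t
  simp only [Function.comp, Complex.real_smul]
  rw [h2, h1, ← h3]
  ring

/-- On the imaginary axis `z = e^(T + iσ)`, `σ` an odd multiple of `π/2`. -/
theorem logCosh_of_exp_sq {T σ : ℝ} (hT : 0 < T) (hσ : exp (-2 * (σ * I)) = -1) :
    logCosh (T + σ * I) = Real.log (2 * Real.sinh T) + σ * I := by
  have h1 : exp (-2 * (T + σ * I)) = ((-Real.exp (-2 * T) : ℝ) : ℂ) := by
    rw [mul_add, Complex.exp_add, hσ]; push_cast; ring
  have h2 : Real.exp (-2 * T) < 1 := Real.exp_lt_one_iff.mpr (by linarith)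
  have h3 : (1 : ℂ) + ((-Real.exp (-2 * T) : ℝ) : ℂ) = ((1 - Real.exp (-2 * T) : ℝ) : ℂ) := by
    push_cast; ring
  have h4 : 2 * Real.sinh T = Real.exp T * (1 - Real.exp (-2 * T)) := by
    rw [Real.sinh_eq, mul_sub, ← Real.exp_add]; ring_nf
  rw [logCosh, h1, h3, ← Complex.ofReal_log (by linarith), h4,
    Real.log_mul (Real.exp_ne_zero _) (by linarith), Real.log_exp]
  push_cast
  ring

/-! ### Expansion of the contour integral in powers of the inverse of the parameter -/

theorem hasSum_inv_sub {c y : ℂ} (h : ‖y‖ < ‖c‖) :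
    HasSum (fun n => y ^ n / c ^ (n + 1)) (c - y)⁻¹ := by
  have hc : c ≠ 0 := norm_pos_iff.mp ((norm_nonneg y).trans_lt h)
  have h1 : ‖y / c‖ < 1 := by rw [norm_div, div_lt_one (norm_pos_iff.mpr hc)]; exact h
  have h2 := (hasSum_geometric_of_norm_lt_one h1).mul_left c⁻¹
  have h3 : c⁻¹ * (1 - y / c)⁻¹ = (c - y)⁻¹ := by
    rw [← mul_inv, mul_sub, mul_one, mul_div_cancel₀ _ hc]
  rw [h3] at h2
  refine h2.congr_fun fun n => ?_
  rw [div_pow, pow_succ]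
  field_simp

theorem hasSum_intervalIntegral_inv_sub {a b M : ℝ} {k X : ℝ → ℂ} {c : ℂ} (hk : Continuous k)
    (hX : Continuous X) (hM : ∀ t ∈ uIoc a b, ‖X t‖ ≤ M) (hM0 : 0 ≤ M) (hc : M < ‖c‖) :
    HasSum (fun n => (∫ t in a..b, k t * X t ^ n) / c ^ (n + 1))
      (∫ t in a..b, k t * (c - X t)⁻¹) := by
  have hc0 : 0 < ‖c‖ := hM0.trans_lt hc
  have hr : M / ‖c‖ < 1 := (div_lt_one hc0).mpr hc
  have hgeom := (hasSum_geometric_of_lt_one (by positivity) hr).mul_left ‖c‖⁻¹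
  have h := intervalIntegral.hasSum_integral_of_dominated_convergence (μ := MeasureTheory.volume)
    (a := a) (b := b) (F := fun n t => k t * (X t ^ n / c ^ (n + 1)))
    (f := fun t => k t * (c - X t)⁻¹) (fun n t => ‖k t‖ * (‖c‖⁻¹ * (M / ‖c‖) ^ n))
    (fun n => (by fun_prop : Continuous fun t => k t * (X t ^ n / c ^ (n + 1))).aestronglyMeasurable)
    (fun n => Eventually.of_forall fun t ht => ?_)
    (Eventually.of_forall fun t _ => hgeom.summable.mul_left _) ?_
    (Eventually.of_forall fun t ht => (hasSum_inv_sub ((hM t ht).trans_lt hc)).mul_left (k t))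
  · refine h.congr_fun fun n => ?_
    rw [← intervalIntegral.integral_div]
    exact intervalIntegral.integral_congr fun t _ => mul_div_assoc _ _ _
  · rw [norm_mul, norm_div, norm_pow, norm_pow, div_pow, pow_succ]
    have : ‖X t‖ ^ n ≤ M ^ n := pow_le_pow_left₀ (norm_nonneg _) (hM t ht) n
    calc ‖k t‖ * (‖X t‖ ^ n / (‖c‖ ^ n * ‖c‖)) ≤ ‖k t‖ * (M ^ n / (‖c‖ ^ n * ‖c‖)) := by gcongr
      _ = _ := by field_simp
  · simp only [tsum_mul_left]
    exact (hk.norm.mul continuous_const).intervalIntegrable _ _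

theorem norm_x_exp_le {T : ℝ} {w : ℂ} (hw : |w.re| ≤ T) : ‖x (exp w)‖ ≤ 2 * Real.exp T := by
  have h := abs_le.mp hw
  rw [x, ← Complex.exp_neg]
  refine (norm_add_le _ _).trans ?_
  rw [Complex.norm_exp, Complex.norm_exp, Complex.neg_re]
  have h1 : Real.exp w.re ≤ Real.exp T := Real.exp_le_exp.mpr h.2
  have h2 : Real.exp (-w.re) ≤ Real.exp T := Real.exp_le_exp.mpr (by linarith [h.1])
  linarith

theorem hasSum_rectInt {a T : ℝ} {K : ℂ → ℂ} (hT : 0 < T) {c : ℂ} (hc : 2 * Real.exp T < ‖c‖)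
    (hh : ∀ θ : ℝ, θ = a ∨ θ = a + 2 * Real.pi → Continuous fun t : ℝ => K (t + θ * I))
    (hv : ∀ t : ℝ, |t| = T → Continuous fun θ : ℝ => K (t + θ * I)) :
    HasSum (fun n => rectInt a T (fun w => K w * x (exp w) ^ n * w) / c ^ (n + 1))
      (rectInt a T (fun w => K w * (c - x (exp w))⁻¹ * w)) := by
  have hX1 : ∀ θ : ℝ, Continuous fun t : ℝ => x (exp (t + θ * I)) := fun θ => by
    simp only [x_exp]; fun_prop
  have hX2 : ∀ t : ℝ, Continuous fun θ : ℝ => x (exp (t + θ * I)) := fun θ => by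
    simp only [x_exp]; fun_prop
  have hor : ∀ θ : ℝ, θ = a ∨ θ = a + 2 * Real.pi →
      HasSum (fun n => (∫ t in (-T)..T, K (t + θ * I) * x (exp (t + θ * I)) ^ n * (t + θ * I)) /
        c ^ (n + 1)) (∫ t in (-T)..T, K (t + θ * I) * (c - x (exp (t + θ * I)))⁻¹ * (t + θ * I)) := by
    intro θ hθ
    have h := hasSum_intervalIntegral_inv_sub (a := -T) (b := T)
      (k := fun t : ℝ => K (t + θ * I) * (t + θ * I)) (X := fun t : ℝ => x (exp (t + θ * I)))
      ((hh θ hθ).mul (by fun_prop)) (hX1 θ) (fun t ht => norm_x_exp_le (by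
        rw [uIoc_of_le (by linarith)] at ht
        rw [re_add_mul_I]; exact abs_le.mpr ⟨ht.1.le, ht.2⟩)) (by positivity) hc
    simpa only [mul_right_comm] using h
  have ver : ∀ t : ℝ, |t| = T →
      HasSum (fun n => arc a t (fun w => K w * x (exp w) ^ n * w) / c ^ (n + 1))
        (arc a t (fun w => K w * (c - x (exp w))⁻¹ * w)) := by
    intro t ht
    have h := hasSum_intervalIntegral_inv_sub (a := a) (b := a + 2 * Real.pi)
      (k := fun θ : ℝ => K (t + θ * I) * (t + θ * I)) (X := fun θ : ℝ => x (exp (t + θ * I)))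
      ((hv t ht).mul (by fun_prop)) (hX2 t) (fun θ _ => norm_x_exp_le (by
        rw [re_add_mul_I]; exact ht.le)) (by positivity) hc
    have h2 := h.mul_left I
    simp only [← mul_div_assoc] at h2
    simpa only [arc, mul_right_comm] using h2
  have h := (((hor a (Or.inl rfl)).sub (hor (a + 2 * Real.pi) (Or.inr rfl))).add
    (ver T (abs_of_pos hT))).sub (ver (-T) (by rw [abs_neg, abs_of_pos hT]))
  refine h.congr_fun fun n => ?_
  rw [rectInt]
  ring

theorem eventually_poles (f : OneForm) (him : ∀ a : ℂ, a.re = 0 → ¬ f.IsPole a) :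
    ∀ᶠ T : ℝ in atTop, ∀ a, f.IsPole a → Real.exp (-T) < ‖a‖ ∧ ‖a‖ < Real.exp T := by
  have h := (Set.Finite.eventually_all (l := atTop) f.finite_poles
    (p := fun a (T : ℝ) => Real.exp (-T) < ‖a‖ ∧ ‖a‖ < Real.exp T)).mpr fun a ha => ?_
  · exact h
  · have ha0 : 0 < ‖a‖ := norm_pos_iff.mpr fun h0 => him a (by rw [h0]; simp) ha
    exact ((Real.tendsto_exp_neg_atTop_nhds_zero).eventually_lt_const ha0).and
      (Real.tendsto_exp_atTop.eventually_gt_atTop _)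

/-! ### Identification of the coefficients -/

theorem continuous_coeff_exp_line {f : OneForm} {g : ℝ → ℂ} (hg : Continuous g)
    (h : ∀ t, ¬ f.IsPole (exp (g t))) : Continuous fun t => f.coeff (exp (g t)) * exp (g t) := by
  have he : Continuous fun t => exp (g t) := by fun_prop
  refine Continuous.mul (continuous_iff_continuousAt.mpr fun t => ?_) he
  exact ContinuousAt.comp (f := fun t => exp (g t)) (analyticAt_coeff (h t)).continuousAt
    he.continuousAt

theorem A_eq_sum (f : OneForm) (y : ℂ) :
    A f y = ∑ a ∈ f.finite_poles.toFinset, resLog f y a :=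
  finsum_mem_eq_finite_toFinset_sum _ f.finite_poles

theorem analyticAt_x {z : ℂ} (hz : z ≠ 0) : AnalyticAt ℂ x z :=
  analyticAt_id.add (analyticAt_inv hz)

/-- The coefficients of the expansion of `𝓐[f]` as contour integrals, by the residue theorem and
the geometric series of `1 / (x₁ - x(z))` on the contour. -/
theorem hasExpansion_A {f : OneForm} (him : ∀ a : ℂ, a.re = 0 → ¬ f.IsPole a) {T : ℝ}
    (hT : 0 < T) (hpole : ∀ a, f.IsPole a → Real.exp (-T) < ‖a‖ ∧ ‖a‖ < Real.exp T) :
    HasExpansion (A f) fun n => (2 * Real.pi * I)⁻¹ *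
      rectInt (-(Real.pi / 2)) T (fun w => f.coeff (exp w) * exp w * x (exp w) ^ n * w) := by
  filter_upwards [(tendsto_norm_cobounded_atTop (E := ℂ)).eventually_gt_atTop (2 * Real.exp T)]
    with y hy
  have h1 := rectInt_eq_sum_residue him hT hpole (P := fun z => (y - x z)⁻¹) (fun w hw => by
    refine AnalyticAt.inv (analyticAt_const.sub (analyticAt_x (Complex.exp_ne_zero w))) ?_
    intro h0
    have h2 := norm_x_exp_le hw
    rw [← sub_eq_zero.mp h0] at h2
    linarith)
  have h2 : A f y = (2 * Real.pi * I)⁻¹ * rectInt (-(Real.pi / 2)) T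
      (fun w => f.coeff (exp w) * exp w * (y - x (exp w))⁻¹ * w) := by
    rw [h1, inv_mul_cancel_left₀ Complex.two_pi_I_ne_zero, A_eq_sum]
    simp only [resLog, div_eq_mul_inv]
  rw [h2]
  have h3 := (hasSum_rectInt (a := -(Real.pi / 2)) (K := fun w => f.coeff (exp w) * exp w) hT hy
    (fun θ hθ => continuous_coeff_exp_line (by fun_prop) fun t =>
      him _ (re_exp_eq_zero (by rwa [im_add_mul_I])))
    (fun t ht => continuous_coeff_exp_line (by fun_prop) fun θ hp => by
      have h4 := hpole _ hp
      rw [Complex.norm_exp, re_add_mul_I, Real.exp_lt_exp, Real.exp_lt_exp] at h4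
      exact absurd ht (abs_lt.mpr h4).ne)).mul_left (2 * Real.pi * I)⁻¹
  refine h3.congr_fun fun n => ?_
  rw [mul_div_assoc]

/-- On the circle, split `ln z = w` as `logCosh w - (logCosh w - w)`; the second part gives half of
`logTerm f`. -/
theorem tendsto_arc_mul_self {f : OneForm} {p q : ℕ → ℂ} (hp : HasExpansion f.pullback p)
    (hq : HasExpansion (logTerm f) q) (n : ℕ) (a : ℝ) :
    Tendsto (fun t : ℝ => arc a t (fun w => f.coeff (exp w) * exp w * x (exp w) ^ n * w) -
      2 * Real.pi * I * (p n * (logCosh (t + a * I) + Real.pi * I) + ∑ k ∈ Finset.range n,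
        p k * ((2 * Complex.cosh (t + a * I)) ^ (n - k) / (n - k : ℕ)))) atTop
      (𝓝 (2 * Real.pi * I * q n / 2)) := by
  have h1 := (hp.tendsto_arc_log n a).sub ((hq.tendsto_arc n a).const_mul (-1 / 2))
  have h2 : 0 - -1 / 2 * (2 * Real.pi * I * q n) = 2 * Real.pi * I * q n / 2 := by ring
  rw [h2] at h1
  refine h1.congr' ?_
  filter_upwards [eventually_gt_atTop 0, hp.eventually_continuous_arc,
    hq.eventually_continuous_arc] with t ht hc1 hc2
  have hl := continuous_logCosh_arc ht
  rw [sub_right_comm]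
  congr 1
  have h3 : arc a t (fun w => f.coeff (exp w) * exp w * x (exp w) ^ n * w) =
      arc a t (fun w => f.pullback (2 * Complex.cosh w) * (2 * Complex.cosh w) ^ n *
        (2 * Complex.sinh w) * logCosh w - -1 / 2 * (logTerm f (2 * Complex.cosh w) *
          (2 * Complex.cosh w) ^ n * (2 * Complex.sinh w))) := by
    unfold arc
    congr 1
    refine intervalIntegral.integral_congr fun θ _ => ?_
    have hw : 0 < ((t : ℂ) + θ * I).re := by rwa [re_add_mul_I]
    simp only
    rw [← pullback_two_cosh f hw, logTerm_two_cosh f hw, x_exp]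
    ring
  rw [h3, arc_sub (h := fun w => -1 / 2 * (logTerm f (2 * Complex.cosh w) *
      (2 * Complex.cosh w) ^ n * (2 * Complex.sinh w)))
    (((hc1.mul (by fun_prop)).mul (by fun_prop)).mul hl)
    (continuous_const.mul ((hc2.mul (by fun_prop)).mul (by fun_prop)))]
  congr 1
  unfold arc
  rw [intervalIntegral.integral_const_mul]
  ring

/-- The part `|z| < 1` of the negative imaginary axis is folded by `z ↦ 1/z` onto the part `|z| > 1`
of the positive one. -/
theorem integral_symm_ray {f : OneForm} (hodd : f.IsOdd)
    (him : ∀ a : ℂ, a.re = 0 → ¬ f.IsPole a) (n : ℕ) (T : ℝ) :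
    ∫ t in (-T)..T, f.coeff (exp (t + (-(Real.pi / 2) : ℝ) * I)) *
        exp (t + (-(Real.pi / 2) : ℝ) * I) * x (exp (t + (-(Real.pi / 2) : ℝ) * I)) ^ n =
      (∫ u in (0 : ℝ)..(2 * Real.sinh T), (I * u) ^ n * f.rayPullback I u * I) +
      ∫ u in (0 : ℝ)..(2 * Real.sinh T), (-I * u) ^ n * f.rayPullback (-I) u * -I := by
  have hs : I ^ 2 = -1 := Complex.I_sq
  have hs' : (-I) ^ 2 = -1 := by rw [neg_sq, Complex.I_sq]
  have he : exp ((Real.pi / 2 : ℝ) * I) = I := by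
    push_cast; exact Complex.exp_pi_div_two_mul_I
  have he' : exp ((-(Real.pi / 2) : ℝ) * I) = -I := by
    push_cast; rw [neg_mul, Complex.exp_neg, Complex.exp_pi_div_two_mul_I, Complex.inv_I]
  rw [← integral_ray him hs he, ← integral_ray him hs' he']
  let F : ℝ → ℂ := fun t => f.coeff (exp (t + (-(Real.pi / 2) : ℝ) * I)) *
    exp (t + (-(Real.pi / 2) : ℝ) * I) * x (exp (t + (-(Real.pi / 2) : ℝ) * I)) ^ n
  have hF : Continuous F := by
    refine Continuous.mul (continuous_coeff_exp_line (by fun_prop) fun t =>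
      him _ (re_exp_eq_zero (Or.inl (im_add_mul_I _ _)))) ?_
    simp only [x_exp]
    fun_prop
  have h1 := intervalIntegral.integral_add_adjacent_intervals
    (hF.intervalIntegrable (-T) 0 (μ := MeasureTheory.volume)) (hF.intervalIntegrable 0 T)
  have h2 := intervalIntegral.integral_comp_neg (a := 0) (b := T) F
  rw [neg_zero] at h2
  refine h1.symm.trans ?_
  rw [← h2]
  congr 1
  · refine intervalIntegral.integral_congr fun t _ => ?_
    have h3 : ((-t : ℝ) : ℂ) + (-(Real.pi / 2) : ℝ) * I = -(t + (Real.pi / 2 : ℝ) * I) := by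
      push_cast; ring
    simp only [F]
    rw [h3, hodd.coeff_exp_neg, x_exp, Complex.cosh_neg]
  · refine intervalIntegral.integral_congr fun t _ => ?_
    simp only [F, x_exp]

/-- The identity of coefficients: the contour of `hasExpansion_A` is pushed to infinity. -/
theorem coeff_A_sub_coeff_logTerm {f : OneForm} (hodd : f.IsOdd)
    (him : ∀ a : ℂ, a.re = 0 → ¬ f.IsPole a) {p q : ℕ → ℂ} (hp : HasExpansion f.pullback p)
    (hp0 : p 0 = 0) (hq : HasExpansion (logTerm f) q) (n : ℕ) {T₀ : ℝ} (hT₀ : 0 < T₀)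
    (hpole₀ : ∀ a, f.IsPole a → Real.exp (-T₀) < ‖a‖ ∧ ‖a‖ < Real.exp T₀) :
    (2 * Real.pi * I)⁻¹ * rectInt (-(Real.pi / 2)) T₀
        (fun w => f.coeff (exp w) * exp w * x (exp w) ^ n * w) - q n =
      n.factorial * (2 * (harmonic n : ℂ) * I1Pred f n + I0 f n) := by
  have h2pi := Complex.two_pi_I_ne_zero
  have hI := factorial_mul_I1Pred hp hp0
  obtain ⟨C, U₀, hC, hU₀, hb⟩ := exists_rayIntegrand_bound hp hI n
  have hs : I ^ 2 = -1 := Complex.I_sq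
  have hs' : (-I) ^ 2 = -1 := by rw [neg_sq, Complex.I_sq]
  have hf : (n.factorial : ℂ) ≠ 0 := Nat.cast_ne_zero.mpr (Nat.factorial_ne_zero _)
  have hU : Tendsto (fun T : ℝ => 2 * Real.sinh T) atTop atTop := by
    refine tendsto_exp_sub_exp_neg.congr fun t => ?_
    rw [Real.sinh_eq]; ring
  set α := (2 * Real.pi * I)⁻¹ * rectInt (-(Real.pi / 2)) T₀
        (fun w => f.coeff (exp w) * exp w * x (exp w) ^ n * w)
  have htail : ∀ s : ℂ, s ^ 2 = -1 → Tendsto (fun T : ℝ => (n.factorial : ℂ) *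
      ∫ u in Ioi (2 * Real.sinh T), rayIntegrand f n 0 s u) atTop (𝓝 0) := by
    intro s hs
    rw [← mul_zero (n.factorial : ℂ)]
    refine Tendsto.const_mul _ (squeeze_zero_norm' ?_ ((tendsto_const_nhds (x := C)).div_atTop hU))
    filter_upwards [hU.eventually_ge_atTop U₀] with T hT
    exact norm_integral_tail_le (hU₀.trans_le hT) fun u hu => hb s hs 0 u le_rfl (hT.trans_lt hu)
  have hlim := ((((tendsto_arc_mul_self hp hq n (-(Real.pi / 2))).add
    (tendsto_arc_mul_self hp hq n (-(-(Real.pi / 2)) - 2 * Real.pi))).const_mul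
      (2 * Real.pi * I)⁻¹).add (htail I hs)).add (htail (-I) hs')
  have hval : (2 * Real.pi * I)⁻¹ * (2 * Real.pi * I * q n / 2 + 2 * Real.pi * I * q n / 2) +
      0 + 0 = q n := by
    rw [add_halves, inv_mul_cancel_left₀ h2pi, add_zero, add_zero]
  rw [hval] at hlim
  have hconst : Tendsto (fun _ : ℝ => α - 2 * p n * (harmonic n : ℂ) - n.factorial * I0 f n)
      atTop (𝓝 (q n)) := by
    refine hlim.congr' ?_
    filter_upwards [hU.eventually_ge_atTop U₀, eventually_gt_atTop 0, eventually_poles f him]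
      with T hTU hT hpole
    have hUpos : 0 < 2 * Real.sinh T := hU₀.trans_le hTU
    have hanal : ∀ w : ℂ, AnalyticAt ℂ (fun z => x z ^ n) (exp w) := fun w =>
      (analyticAt_x (Complex.exp_ne_zero w)).pow n
    -- the contour integral does not depend on `T`
    have hα : α = (2 * Real.pi * I)⁻¹ * rectInt (-(Real.pi / 2)) T
        (fun w => f.coeff (exp w) * exp w * x (exp w) ^ n * w) := by
      rw [rectInt_eq_sum_residue him hT hpole (P := fun z => x z ^ n) fun w _ => hanal w,
        ← rectInt_eq_sum_residue him hT₀ hpole₀ (P := fun z => x z ^ n) fun w _ => hanal w]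
    have hrect := rectInt_mul_self (a := -(Real.pi / 2)) (T := T)
      (K := fun w => f.coeff (exp w) * exp w * x (exp w) ^ n)
      (fun w => by
        simp only [hodd.coeff_exp_neg, x_exp, Complex.cosh_neg])
      (fun w k => by simp only [exp_add_period])
      (by
        refine Continuous.mul (continuous_coeff_exp_line (by fun_prop) fun t =>
          him _ (re_exp_eq_zero (Or.inl (im_add_mul_I _ _)))) ?_
        simp only [x_exp]
        fun_prop)
    have hI0 : I0 f n = (n.factorial : ℂ)⁻¹ * (-rayFinitePart f p n I (2 * Real.sinh T) -
        rayFinitePart f p n (-I) (2 * Real.sinh T)) :=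
      (tendsto_I0Reg him hI n hUpos fun s hs ε u hε hu => hb s hs ε u hε
        (hTU.trans_lt hu)).limUnder_eq
    have e1 : exp ((-(Real.pi / 2) : ℝ) * I) = -I := by
      push_cast; rw [neg_mul, Complex.exp_neg, Complex.exp_pi_div_two_mul_I, Complex.inv_I]
    have e2 : exp ((-(-(Real.pi / 2)) - 2 * Real.pi : ℝ) * I) = I := by
      have : ((-(-(Real.pi / 2)) - 2 * Real.pi : ℝ) : ℂ) * I =
        Real.pi / 2 * I - 2 * Real.pi * I := by push_cast; ring
      rw [this, Complex.exp_sub, Complex.exp_two_pi_mul_I, Complex.exp_pi_div_two_mul_I, div_one]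
    have esq : ∀ {s : ℂ} {σ : ℝ}, s ^ 2 = -1 → exp (σ * I) = s → exp (-2 * (σ * I)) = -1 := by
      intro s σ hs hσ
      rw [show -2 * (σ * I) = -(σ * I + σ * I) by ring, Complex.exp_neg, Complex.exp_add, hσ, ← sq,
        hs]
      norm_num
    rw [hα, hrect, integral_symm_ray hodd him, hI0, logCosh_of_exp_sq hT (esq hs' e1),
      logCosh_of_exp_sq hT (esq hs e2), two_cosh_of_exp hs' e1, two_cosh_of_exp hs e2,
      mul_inv_cancel_left₀ hf, rayFinitePart, rayFinitePart]
    push_cast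
    field_simp
    ring
  have h := tendsto_nhds_unique tendsto_const_nhds hconst
  rw [← h, ← hI]
  ring

theorem resLog_eq_zero {f : OneForm} {y a : ℂ} (hre : a.re ≠ 0) (ha : ¬ f.IsPole a)
    (hy : y ≠ x a) : resLog f y a = 0 := by
  have ha0 : a ≠ 0 := by rintro rfl; simp at hre
  exact residue_eq_zero_of_analyticAt (((analyticAt_coeff ha).mul (analyticAt_ln hre)).div
    (analyticAt_const.sub (analyticAt_x ha0)) (sub_ne_zero.mpr hy))

end P1

theorem corollary4p2 (f : P1.OneForm) (hodd : f.IsOdd) (hinfty : ¬ f.HasPoleAtInfty)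
    (him : ∀ a : ℂ, a.re = 0 → ¬ f.IsPole a) :
    -- the regularised integrals are well defined
    (∀ b : ℕ,
      (∀ ε : ℝ, 0 < ε →
        MeasureTheory.IntegrableOn (P1.rayIntegrand f b ε Complex.I) (Ioi 0) ∧
        MeasureTheory.IntegrableOn (P1.rayIntegrand f b ε (-Complex.I)) (Ioi 0)) ∧
      Tendsto (P1.I0Reg f b) (𝓝[>] 0) (𝓝 (P1.I0 f b))) ∧
    -- the asymptotic expansion, to all orders
    (∀ N : ℕ,
      (fun x₁ : ℂ => P1.A f x₁ -
          (P1.logTerm f x₁ + ∑ n ∈ Finset.range N, P1.expansionTerm f x₁ n))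
        =O[Bornology.cobounded ℂ] fun x₁ : ℂ => (x₁ ^ (N + 1))⁻¹) ∧
    -- it is a convergent Laurent series in a neighbourhood of infinity
    (∀ᶠ x₁ in Bornology.cobounded ℂ,
      HasSum (P1.expansionTerm f x₁) (P1.A f x₁ - P1.logTerm f x₁)) ∧
    -- if the only poles are `1` and `-1`, the left-hand side is the sum of the residues there
    ((∀ a : ℂ, f.IsPole a → a = 1 ∨ a = -1) →
      ∀ᶠ x₁ in Bornology.cobounded ℂ, P1.A f x₁ = P1.resLog f x₁ 1 + P1.resLog f x₁ (-1)) := by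
  obtain ⟨p, hp, hp0⟩ := P1.exists_hasExpansion_pullback f hinfty
  obtain ⟨q, hq⟩ := P1.exists_hasExpansion_logTerm f hinfty
  have hI := P1.factorial_mul_I1Pred hp hp0
  have hs : Complex.I ^ 2 = -1 := Complex.I_sq
  have hs' : (-Complex.I) ^ 2 = -1 := by rw [neg_sq, Complex.I_sq]
  obtain ⟨T, hT, hpole⟩ := ((eventually_gt_atTop (0 : ℝ)).and (P1.eventually_poles f him)).exists
  have hexp := (P1.hasExpansion_A him hT hpole).sub hq
  have hterm : ∀ y : ℂ, P1.expansionTerm f y = fun n => ((2 * Real.pi * Complex.I)⁻¹ *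
      P1.rectInt (-(Real.pi / 2)) T (fun w => f.coeff (Complex.exp w) * Complex.exp w *
        P1.x (Complex.exp w) ^ n * w) - q n) / y ^ (n + 1) := fun y => by
    ext n
    rw [P1.coeff_A_sub_coeff_logTerm hodd him hp hp0 hq n hT hpole, P1.expansionTerm]
    ring
  refine ⟨fun b => ⟨fun ε hε => ⟨P1.integrableOn_rayIntegrand him hp hI b hs hε,
    P1.integrableOn_rayIntegrand him hp hI b hs' hε⟩, ?_⟩, fun N => ?_, ?_, fun h1 => ?_⟩
  · obtain ⟨C, U, -, hU, hb⟩ := P1.exists_rayIntegrand_bound hp hI b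
    exact tendsto_nhds_limUnder ⟨_, P1.tendsto_I0Reg him hI b hU hb⟩
  · simp only [hterm, ← sub_sub]
    exact hexp.isBigO N
  · simp only [hterm]
    exact hexp
  · filter_upwards [Bornology.eventually_ne_cobounded (P1.x 1),
      Bornology.eventually_ne_cobounded (P1.x (-1))] with y hy1 hy2
    rw [P1.A_eq_sum, ← Finset.sum_pair (f := P1.resLog f y) (by norm_num : (1 : ℂ) ≠ -1)]
    refine Finset.sum_subset (fun a ha => ?_) fun a ha hna => ?_
    · simpa using h1 a (by simpa using ha)
    · have hna' : ¬ f.IsPole a := by simpa using hna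
      rcases (by simpa using ha : a = 1 ∨ a = -1) with rfl | rfl
      · exact P1.resLog_eq_zero (by simp) hna' hy1
      · exact P1.resLog_eq_zero (by simp) hna' hy2
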